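/- Let $N=2^m>1$. For $x_0,\dots,x_{N-1}\in\mathbb R$ let $$C_k=2\sum_{n=0}^{N-1}x_n\cos\Big[\frac{\pi}{N}\Big(n+\frac12\Big)k\Big],\qquad C_k^{\mathrm{II}}=\sqrt{\frac{2-\delta_{k,0}}{N}}\sum_{n=0}^{N-1}x_n\cos\Big[\frac{\pi}{N}\Big(n+\frac12\Big)k\Big]\qquad(0\le k<N)$$ be its DCT-II and its unitary DCT-II. A flop is one real addition, one real subtraction, or one multiplication by a real constant independent of the input (multiplications by $-1$ included); an algorithm is a straight-line program, i.e. a finite sequence of flops on inputs and earlier results, and computing its constants and indexing are free. (a) Let $\tilde x$ be the sequence of length $4N$ with $\tilde x_{2n}=\tilde x_{4N-2n-2}=0$ and $\tilde x_{2n+1}=\tilde x_{4N-(2n+1)}=x_n$ for $0\le n<N$. It is real and even, and $C_k=\sum_{n=0}^{4N-1}\tilde x_n e^{-2\pi i nk/(4N)}$ for $0\le k<N$. (b) Put $\omega_{M}=e^{-2\pi i/M}$, and for powers of two $M$ let $s_{M,k}=1$ if $M\le4$, and otherwise, with $k_4=k\bmod\frac M4$, $s_{M,k}=s_{M/4,k_4}\cos(2\pi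 k_4/M)$ if $k_4\le M/8$ and $s_{M,k}=s_{M/4,k_4}\sin(2\pi k_4/M)$ otherwise. Put $t_{M,k}=\omega_M^k s_{M/4,k}/s_{M,k}$. For $\ell\in\{1,2,4\}$ let $F_\ell$ be the rescaled conjugate-pair split-radix FFT for real data. On real $y_0,\dots,y_{M-1}$ it returns $X_k$, $0\le k\le M/2$, as follows. For $M=1$: $X_0=y_0$. For $M=2$: $X_0=y_0+y_1$ and $X_1=(y_0-y_1)/s_{2\ell,1}$. For $M\ge4$ let $\ell'=2,4,2$ for $\ell=1,2,4$ respectively, let $U=F_{\ell'}(y_{2n})_{0\le n<M/2}$, $Z=F_1(y_{4n+1})_{0\le n<M/4}$, $Z'=F_1(y_{4n-1})_{0\le n<M/4}$ (indices modulo $M$), and for $0\le k\le M/8$ put $S_k=t_{M,k}Z_k+t_{M,k}^*Z'_k$, $D_k=t_{M,k}Z_k-t_{M,k}^*Z'_k$. With $\rho_j=s_{M,k}/s_{\ell M,j}$ and $\mu_j=1$ for $\ell=1,2$, and $\rho_j=1$ and $\mu_j=s_{M,k}/s_{4M,j}$ for $\ell=4$, the outputs are $$X_k=\mu_k(U_k+\rho_kS_k),\qquad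 X_{k+M/4}=\mu_{k+M/4}(U^*_{M/4-k}-i\rho_{k+M/4}D_k),$$ $$X_{M/4-k}=\mu_{M/4-k}(U_{M/4-k}-i\rho_{k+M/4}D_k^*),\qquad X_{M/2-k}=\mu_{M/2-k}(U_k^*-\rho_kS_k^*).$$ Redundant operations are discarded: common subexpressions are computed once, multiplications by factors that are identically $1$ are omitted, the steps $k=0$ and $k=M/8$ use that $Z_k,Z'_k$ are real, $t_{M,0}=1$ and $t_{M,M/8}=1-i$, and the steps $0<k<M/8$ use $t_{M,k}=1-i\tan(2\pi k/M)$. The DCT-II algorithm puts $\tilde y_n=x_{2n}$, $\tilde y_{N-1-n}=x_{2n+1}$ for $0\le n<N/2$, computes $Z=F_1(\tilde y)$, and outputs $C_0=2Z_0$, $C_{N/2}=\sqrt2\,Z_{N/2}$, and, for $1\le k<N/2$, $$C_k=2\,\mathrm{Re}(\omega_{4N}^k s_{N,k}Z_k),\qquad C_{N-k}=-2\,\mathrm{Im}(\omega_{4N}^k s_{N,k}Z_k).$$ For the unitary DCT-II, the normalizing factor $2$ is replaced by $\sqrt{1/N}$ for $k=0$ and by $\sqrt{2/N}$ for $k\neq0$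 (so $\sqrt2=2/\sqrt2$ becomes $\sqrt{2/N}/\sqrt2$). These algorithms are straight-line programs that compute $C_0,\dots,C_{N-1}$, respectively $C^{\mathrm{II}}_0,\dots,C^{\mathrm{II}}_{N-1}$, exactly for all real inputs, each with exactly $$\frac{17}{9}N\log_2N-\frac{17}{27}N-\frac19(-1)^{\log_2N}\log_2N+\frac{7}{54}(-1)^{\log_2N}+\frac32$$ flops. (c) This count is $\frac{17}{9}N\log_2N+O(N)$. It is at most the previous count $2N\log_2N-N+2$ for all $N=2^m>1$, and it is strictly smaller if and only if $N\ge16$. -/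

import Mathlib

/-! ## The transforms -/

/-- The DCT-II in the normalization `C_k = 2 ∑ x_n cos[π (n + 1/2) k / N]`. -/
noncomputable def dctII {N : ℕ} (x : Fin N → ℝ) (k : Fin N) : ℝ :=
  2 * ∑ n : Fin N, x n * Real.cos (Real.pi / N * ((n : ℝ) + 1 / 2) * (k : ℝ))

/-- The orthogonal (unitary) DCT-II,
`C_k = √((2 - δ_{k,0}) / N) ∑ x_n cos[π (n + 1/2) k / N]`. -/
noncomputable def dctIIUnitary {N : ℕ} (x : Fin N → ℝ) (k : Fin N) : ℝ :=
  Real.sqrt ((2 - if (k : ℕ) = 0 then 1 else 0) / N) *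
    ∑ n : Fin N, x n * Real.cos (Real.pi / N * ((n : ℝ) + 1 / 2) * (k : ℝ))

/-- The real-even, zero-interleaved extension of `x_0, …, x_{N-1}` to length `4 N`: its entries
with even index vanish, and the entries with index `2 n + 1` and `4 N - (2 n + 1)` are `x_n`
for `0 ≤ n < N`. -/
def evenExtension {N : ℕ} [NeZero N] (x : Fin N → ℝ) (j : ZMod (4 * N)) : ℝ :=
  if j.val % 2 = 0 then 0
  else if j.val < 2 * N then x (Fin.ofNat N (j.val / 2))
  else x (Fin.ofNat N ((4 * N - 1 - j.val) / 2))

/-! ## Straight-line programs over the reals and their operation count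

A program on `M` real inputs is a finite list of instructions. Each instruction performs one real
addition, one real subtraction, or one multiplication by a real constant that does not depend on
the inputs, on values that are inputs or results of earlier instructions. Each instruction counts
as one operation (multiplications by `-1` included). Only indexing and the computation of the
constants are free. -/

/-- An operand: the `i`-th input, or the result of the `i`-th instruction (counted from `0`). -/
inductive Reg (M : ℕ) : Type
  | inp (i : Fin M) : Reg M
  | tmp (i : ℕ) : Reg M

/-- One arithmetic instruction. -/
inductive Instr (M : ℕ) : Type
  | add (a b : Reg M) : Instr M
  | sub (a b : Reg M) : Instr M
  | mul (c : ℝ) (a : Reg M) : Instr M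

/-- The value of an operand, for inputs `x` and the list `v` of the results so far. -/
def Reg.val {M : ℕ} (x : Fin M → ℝ) (v : List ℝ) : Reg M → ℝ
  | .inp i => x i
  | .tmp i => v.getD i 0

/-- The result of an instruction. -/
noncomputable def Instr.val {M : ℕ} (x : Fin M → ℝ) (v : List ℝ) : Instr M → ℝ
  | .add a b => a.val x v + b.val x v
  | .sub a b => a.val x v - b.val x v
  | .mul c a => c * a.val x v

/-- The operand is available once `n` instructions have been executed. -/
def Reg.Available {M : ℕ} (n : ℕ) : Reg M → Prop
  | .inp _ => True
  | .tmp i => i < n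

/-- The instruction only reads operands available once `n` instructions have been executed. -/
def Instr.Available {M : ℕ} (n : ℕ) : Instr M → Prop
  | .add a b => a.Available n ∧ b.Available n
  | .sub a b => a.Available n ∧ b.Available n
  | .mul _ a => a.Available n

/-- The list of the results of all instructions, in the order of execution. -/
noncomputable def execute {M : ℕ} (x : Fin M → ℝ) (code : List (Instr M)) : List ℝ :=
  code.foldl (fun v ins => v ++ [ins.val x v]) []

/-- A straight-line program with `M` real inputs and `M` real outputs. -/
structure Program (M : ℕ) where
  code : List (Instr M)
  out : Fin M → Reg M

/-- The number of real additions (and subtractions) and multiplications of a program. -/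
def Program.flops {M : ℕ} (P : Program M) : ℕ := P.code.length

/-- The outputs of a program on given inputs. -/
noncomputable def Program.run {M : ℕ} (P : Program M) (x : Fin M → ℝ) (k : Fin M) : ℝ :=
  (P.out k).val x (execute x P.code)

/-- No instruction reads a result that is not yet there, and all outputs are computed. -/
def Program.Valid {M : ℕ} (P : Program M) : Prop :=
  (∀ (i : ℕ) (h : i < P.code.length), (P.code[i]).Available i) ∧
    ∀ k, (P.out k).Available P.code.length

/-! ## Writing programs -/

/-- A procedure that appends instructions to a program and returns an `α`. -/
abbrev Build (M : ℕ) (α : Type) : Type := StateM (List (Instr M)) α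

/-- Append one instruction and return the operand that refers to its result. -/
def emit {M : ℕ} (ins : Instr M) : Build M (Reg M) := do
  let p ← get
  set (p ++ [ins])
  pure (Reg.tmp p.length)

/-- A complex number, held as its real and imaginary parts. -/
structure CReg (M : ℕ) where
  re : Reg M
  im : Reg M

/-- `for k = 1 to n do body k`; the results are returned as a table, which is `d` outside
`1, …, n`. -/
def forOneTo {M : ℕ} {α : Type} (d : α) (body : ℕ → Build M α) : ℕ → Build M (ℕ → α)
  | 0 => pure fun _ => d
  | n + 1 => do
    let W ← forOneTo d body n
    let a ← body (n + 1)
    pure (Function.update W (n + 1) a)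

/-- Multiplication of a complex number by a real constant: two real multiplications. -/
def cscale {M : ℕ} (c : ℝ) (z : CReg M) : Build M (CReg M) := do
  let re ← emit (.mul c z.re)
  let im ← emit (.mul c z.im)
  pure ⟨re, im⟩

/-! ## The rescaled conjugate-pair split-radix FFT for real inputs -/

/-- The scale factor `s_{N,k}` for `N = 2 ^ m`: it is `1` for `N ≤ 4`; for `N > 4`, with
`k₄ = k mod N/4`, it is `s_{N/4,k₄} cos(2πk₄/N)` if `k₄ ≤ N/8`, and `s_{N/4,k₄} sin(2πk₄/N)`
otherwise. -/
noncomputable def scaleFactor : ℕ → ℕ → ℝ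
  | 0, _ => 1
  | 1, _ => 1
  | 2, _ => 1
  | m + 3, k =>
    let k₄ := k % 2 ^ (m + 1)
    if k₄ ≤ 2 ^ m then scaleFactor (m + 1) k₄ * Real.cos (2 * Real.pi * k₄ / 2 ^ (m + 3))
    else scaleFactor (m + 1) k₄ * Real.sin (2 * Real.pi * k₄ / 2 ^ (m + 3))

/-- The three mutually recursive subroutines: of a sequence of length `N`, they compute the DFT
divided by `s_{ℓN,k}` for `ℓ = 1, 2, 4`. -/
inductive Scaling : Type
  | one
  | two
  | four

/-- The scaling of the half-size subtransform of the even-indexed inputs. -/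
def Scaling.sub : Scaling → Scaling
  | .one => .two
  | .two => .four
  | .four => .two

/-- The step `k = 0` for size `N = 2 ^ m`, where `t_{N,0} = 1` and all data are real.
Here `u0 = U_0`, `u1 = U_{N/4}`, `z = Z_0`, `z' = Z'_0`. Returns `X_0`, `X_{N/4}`, `X_{N/2}`, where
`X_{N/4} = U_{N/4} - i (Z_0 - Z'_0)` up to the scale factors. -/
noncomputable def stepZero {M : ℕ} (ℓ : Scaling) (m : ℕ) (u0 u1 z z' : Reg M) :
    Build M (Reg M × CReg M × Reg M) := do
  let s ← emit (.add z z')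
  let d ← emit (.sub z' z)
  let x0 ← emit (.add u0 s)
  let x2 ← emit (.sub u0 s)
  match ℓ with
  | .one => pure (x0, ⟨u1, d⟩, x2)
  | .two => do
    let d ← emit (.mul (1 / scaleFactor (m + 1) (2 ^ m / 4)) d)
    pure (x0, ⟨u1, d⟩, x2)
  | .four => do
    let x1 ← cscale (1 / scaleFactor (m + 2) (2 ^ m / 4)) ⟨u1, d⟩
    let x2 ← emit (.mul (1 / scaleFactor (m + 2) (2 ^ m / 2)) x2)
    pure (x0, x1, x2)

/-- The step `k = N/8` for size `N = 2 ^ m`, where `t_{N,N/8} = 1 - i`, and where `z = Z_{N/8}` and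
`z' = Z'_{N/8}` are real. Here `u = U_{N/8}`. Returns `X_{N/8}` and `X_{3N/8}`, where, up to the
scale factors, `X_{N/8} = U_{N/8} + ((Z + Z') - i (Z - Z'))` and
`X_{3N/8} = U_{N/8}^* - i ((Z - Z') - i (Z + Z'))`. -/
noncomputable def stepEighth {M : ℕ} (ℓ : Scaling) (m : ℕ) (u : CReg M) (z z' : Reg M) :
    Build M (CReg M × CReg M) := do
  let k := 2 ^ m / 8
  let q := 2 ^ m / 4
  let a ← emit (.add z z')
  let b ← emit (.sub z' z)
  let w ← match ℓ with
    | .two => cscale (scaleFactor m k / scaleFactor (m + 1) k) ⟨a, b⟩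
    | _ => pure ⟨a, b⟩
  let xr ← emit (.add u.re w.re)
  let xi ← emit (.add u.im w.im)
  let yr ← emit (.sub u.re w.re)
  let yi ← emit (.sub w.im u.im)
  match ℓ with
  | .four => do
    let x ← cscale (scaleFactor m k / scaleFactor (m + 2) k) ⟨xr, xi⟩
    let y ← cscale (scaleFactor m k / scaleFactor (m + 2) (k + q)) ⟨yr, yi⟩
    pure (x, y)
  | _ => pure (⟨xr, xi⟩, ⟨yr, yi⟩)

/-- The step `0 < k < N/8` for size `N = 2 ^ m`, where `t_{N,k} = ω_N^k s_{N/4,k} / s_{N,k}` equals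
`1 - i tan(2πk/N)`. Here `u = U_k`, `v = U_{N/4-k}`, `z = Z_k`, `z' = Z'_k`. Returns `X_k`,
`X_{k+N/4}`, `X_{N/4-k}`, `X_{N/2-k}`, which, with `S = t Z_k + t^* Z'_k` and
`D = t Z_k - t^* Z'_k`, are, up to the scale factors, `U_k + S`, `U_{N/4-k}^* - i D`,
`U_{N/4-k} - i D^*` and `U_k^* - S^*`. -/
noncomputable def stepGeneral {M : ℕ} (ℓ : Scaling) (m k : ℕ) (u v z z' : CReg M) :
    Build M (CReg M × CReg M × CReg M × CReg M) := do
  let q := 2 ^ m / 4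
  let τ := Real.tan (2 * Real.pi * k / 2 ^ m)
  -- p = t Z_k
  let zi ← emit (.mul τ z.im)
  let zr ← emit (.mul τ z.re)
  let pr ← emit (.add z.re zi)
  let pi ← emit (.sub z.im zr)
  -- r = t^* Z'_k
  let zi' ← emit (.mul τ z'.im)
  let zr' ← emit (.mul τ z'.re)
  let rr ← emit (.sub z'.re zi')
  let ri ← emit (.add z'.im zr')
  -- S, and the parts -(Re D) and Im D of D
  let sr ← emit (.add pr rr)
  let si ← emit (.add pi ri)
  let dr ← emit (.sub rr pr)
  let di ← emit (.sub pi ri)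
  let S ← match ℓ with
    | .two => cscale (scaleFactor m k / scaleFactor (m + 1) k) ⟨sr, si⟩
    | _ => pure ⟨sr, si⟩
  let D ← match ℓ with
    | .two => cscale (scaleFactor m k / scaleFactor (m + 1) (k + q)) ⟨dr, di⟩
    | _ => pure ⟨dr, di⟩
  let ar ← emit (.add u.re S.re)
  let ai ← emit (.add u.im S.im)
  let br ← emit (.add v.re D.im)
  let bi ← emit (.sub D.re v.im)
  let cr ← emit (.sub v.re D.im)
  let ci ← emit (.add v.im D.re)
  let er ← emit (.sub u.re S.re)
  let ei ← emit (.sub S.im u.im)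
  match ℓ with
  | .four => do
    let a ← cscale (scaleFactor m k / scaleFactor (m + 2) k) ⟨ar, ai⟩
    let b ← cscale (scaleFactor m k / scaleFactor (m + 2) (k + q)) ⟨br, bi⟩
    let c ← cscale (scaleFactor m k / scaleFactor (m + 2) (q - k)) ⟨cr, ci⟩
    let e ← cscale (scaleFactor m k / scaleFactor (m + 2) (2 * q - k)) ⟨er, ei⟩
    pure (a, b, c, e)
  | _ => pure (⟨ar, ai⟩, ⟨br, bi⟩, ⟨cr, ci⟩, ⟨er, ei⟩)

/-- The new FFT of size `N = 2 ^ m` for the real inputs `x 0, …, x (N - 1)`: the returned table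
holds, for `0 ≤ k ≤ N/2`, the `k`-th output of the DFT divided by `s_{ℓN,k}`. The outputs for
`k = 0` and `k = N/2` are real; their imaginary fields are placeholders that are never read. -/
noncomputable def realFFT {M : ℕ} : Scaling → ℕ → (ℕ → Reg M) → Build M (ℕ → CReg M)
  | _, 0, x => pure fun _ => ⟨x 0, x 0⟩
  | ℓ, 1, x => do
    let a ← emit (.add (x 0) (x 1))
    let b ← emit (.sub (x 0) (x 1))
    let b ← match ℓ with
      | .four => emit (.mul (1 / scaleFactor 3 1) b)
      | _ => pure b
    pure fun k => if k = 0 then ⟨a, a⟩ else ⟨b, b⟩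
  | ℓ, 2, x => do
    let U ← realFFT ℓ.sub 1 fun n => x (2 * n)
    let Z ← realFFT .one 0 fun n => x (4 * n + 1)
    let Z' ← realFFT .one 0 fun n => x ((4 * n + 3) % 4)
    let (x0, x1, x2) ← stepZero ℓ 2 (U 0).re (U 1).re (Z 0).re (Z' 0).re
    pure fun k => if k = 0 then ⟨x0, x0⟩ else if k = 1 then x1 else ⟨x2, x2⟩
  | ℓ, m + 3, x => do
    let N := 2 ^ (m + 3)
    let h := 2 ^ m
    let U ← realFFT ℓ.sub (m + 2) fun n => x (2 * n)
    let Z ← realFFT .one (m + 1) fun n => x (4 * n + 1)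
    let Z' ← realFFT .one (m + 1) fun n => x ((4 * n + (N - 1)) % N)
    let (x0, x1, x2) ← stepZero ℓ (m + 3) (U 0).re (U (2 * h)).re (Z 0).re (Z' 0).re
    let (y1, y3) ← stepEighth ℓ (m + 3) (U h) (Z h).re (Z' h).re
    let W ← forOneTo (y1, y1, y1, y1)
      (fun k => stepGeneral ℓ (m + 3) k (U k) (U (2 * h - k)) (Z k) (Z' k)) (h - 1)
    pure fun k =>
      if k = 0 then ⟨x0, x0⟩
      else if k < h then (W k).1
      else if k = h then y1
      else if k < 2 * h then (W (2 * h - k)).2.2.1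
      else if k = 2 * h then x1
      else if k < 3 * h then (W (k - 2 * h)).2.1
      else if k = 3 * h then y3
      else if k < 4 * h then (W (4 * h - k)).2.2.2
      else ⟨x2, x2⟩

/-! ## The new DCT-II -/

/-- The body of the DCT-II algorithm of size `N = 2 ^ m`; the output with index `0` is normalized
by the factor `c₀`, the other ones by the factor `c`. -/
noncomputable def newDCTBody (m : ℕ) (c₀ c : ℝ) : Build (2 ^ m) (ℕ → Reg (2 ^ m)) := do
  let N := 2 ^ m
  -- the even-indexed inputs, followed by the odd-indexed inputs in reverse order
  let y : ℕ → Reg (2 ^ m) := fun n =>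
    if n < N / 2 then .inp (Fin.ofNat (2 ^ m) (2 * n))
    else .inp (Fin.ofNat (2 ^ m) (2 * (N - 1 - n) + 1))
  let Z ← realFFT .one m y
  let first ← emit (.mul c₀ (Z 0).re)
  -- C_k = c Re(ω_{4N}^k s_{N,k} Z_k) and C_{N-k} = - c Im(ω_{4N}^k s_{N,k} Z_k)
  let W ← forOneTo (first, first)
    (fun k => do
      let α := c * scaleFactor m k * Real.cos (2 * Real.pi * k / (4 * 2 ^ m))
      let β := c * scaleFactor m k * Real.sin (2 * Real.pi * k / (4 * 2 ^ m))
      let a ← emit (.mul α (Z k).re)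
      let b ← emit (.mul β (Z k).im)
      let d ← emit (.mul β (Z k).re)
      let e ← emit (.mul α (Z k).im)
      let p ← emit (.add a b)
      let r ← emit (.sub d e)
      pure (p, r)) (N / 2 - 1)
  let middle ← emit (.mul (c / Real.sqrt 2) (Z (N / 2)).re)
  pure fun k =>
    if k = 0 then first
    else if k < N / 2 then (W k).1
    else if k = N / 2 then middle
    else (W (N - k)).2

/-- The program of the DCT-II algorithm of size `2 ^ m` with normalization factors `c₀`, `c`. -/
noncomputable def newDCTProgram (m : ℕ) (c₀ c : ℝ) : Program (2 ^ m) :=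
  let r := (newDCTBody m c₀ c).run []
  ⟨r.2, fun k => r.1 k⟩

/-- The new DCT-II algorithm of size `2 ^ m`. -/
noncomputable def newDCT (m : ℕ) : Program (2 ^ m) := newDCTProgram m 2 2

/-- The same algorithm with the constants adapted to the unitary normalization. -/
noncomputable def newDCTUnitary (m : ℕ) : Program (2 ^ m) :=
  newDCTProgram m (Real.sqrt (1 / 2 ^ m)) (Real.sqrt (2 / 2 ^ m))

/-! ## Operation counts -/

/-- The new operation count for the DCT-II of a power-of-two size `N`. -/
noncomputable def newFlopCount (N : ℕ) : ℝ :=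
  17 / 9 * N * Nat.log 2 N - 17 / 27 * N - 1 / 9 * (-1) ^ Nat.log 2 N * Nat.log 2 N
    + 7 / 54 * (-1) ^ Nat.log 2 N + 3 / 2

/-- The previously lowest operation count for the DCT-II of a power-of-two size `N`. -/
noncomputable def previousFlopCount (N : ℕ) : ℝ :=
  2 * N * Nat.log 2 N - N + 2

/-! ## Executing programs -/

/-! Two arguments run in parallel: a program logic, which turns building procedures into statements
about the values held and the number of instructions, and the algebra of the rescaled transform.

Correctness of the FFT rests on three facts. (i) For real data every output follows from the
conjugate-pair split into the indices 2n, 4n+1 and 4n-1 modulo N. The twiddle factors of the last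
two are complex conjugates, so the four outputs at k, N/4+k, N/4-k and N/2-k come from the same S
and D (`powDFT_split`, `powDFT_butterfly`). (ii) For k ≤ N/8 the recursion for s gives s_{N,k} =
s_{N/4,k} cos(2πk/N). Hence the rescaled twiddle factor is 1 - i tan(2πk/N), and it carries a
quarter-size output divided by s_{N/4,k} to a twiddled one divided by s_{N,k}
(`scaleFactor_mul_twiddle`, `twiddle_mul_div`). (iii) s_{N,k} is unchanged under k ↦ N/4-k and has
period N/4 (`scaleFactor_symm`). One common factor therefore serves all outputs of a step, and the
scalings 1, 2, 4 fit together across the recursion (`mu_mul_add_rho_mul`).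

The DCT-II follows by rotating the DFT of the reordered input by ω_{4N}^k. The real part of the
result is the unnormalized C_k, and minus the imaginary part is C_{N-k}. The scale s_{N,k} is
absorbed into constants that are multiplied anyway, so undoing it is free.

The cost recursion is linear with forcing terms 1 and 2^m, and its closed form is checked by
induction (`costFFT_eq`). What remains is to add the cost of the rotations and to compare two
explicit functions of m. -/

theorem execute_concat {M : ℕ} (x : Fin M → ℝ) (p : List (Instr M)) (i : Instr M) :
    execute x (p ++ [i]) = execute x p ++ [i.val x (execute x p)] := by
  simp [execute, List.foldl_append]

theorem length_execute {M : ℕ} (x : Fin M → ℝ) (p : List (Instr M)) :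
    (execute x p).length = p.length := by
  induction p using List.reverseRecOn with
  | nil => rfl
  | append_singleton p i ih => simp [execute_concat, ih]

theorem Reg.val_append {M : ℕ} (x : Fin M → ℝ) (v w : List ℝ) {r : Reg M}
    (h : r.Available v.length) : r.val x (v ++ w) = r.val x v := by
  cases r with
  | inp i => rfl
  | tmp i => exact List.getD_append _ _ _ _ h

/-- Results are only ever appended, so an operand that is already available keeps its value under
any extension of the program. -/
theorem Reg.val_execute_append {M : ℕ} (x : Fin M → ℝ) (p q : List (Instr M)) {r : Reg M}
    (h : r.Available p.length) : r.val x (execute x (p ++ q)) = r.val x (execute x p) := by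
  induction q using List.reverseRecOn with
  | nil => simp
  | append_singleton q i ih =>
    rw [← List.append_assoc, execute_concat, Reg.val_append, ih]
    rw [length_execute]
    cases r with
    | inp i => trivial
    | tmp i => simp only [Reg.Available, List.length_append] at h ⊢; omega

theorem Instr.val_execute_append {M : ℕ} (x : Fin M → ℝ) (p q : List (Instr M)) {i : Instr M}
    (h : i.Available p.length) : i.val x (execute x (p ++ q)) = i.val x (execute x p) := by
  cases i with
  | add a b => simp only [Instr.val, Reg.val_execute_append x p q h.1,
      Reg.val_execute_append x p q h.2]
  | sub a b => simp only [Instr.val, Reg.val_execute_append x p q h.1,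
      Reg.val_execute_append x p q h.2]
  | mul c a => simp only [Instr.val, Reg.val_execute_append x p q (r := a) h]

/-- The instructions `q`, appended to a program of length `n`, only read results that are there. -/
def AvailFrom {M : ℕ} : ℕ → List (Instr M) → Prop
  | _, [] => True
  | n, i :: q => i.Available n ∧ AvailFrom (n + 1) q

theorem availFrom_append {M : ℕ} (n : ℕ) (p q : List (Instr M)) :
    AvailFrom n (p ++ q) ↔ AvailFrom n p ∧ AvailFrom (n + p.length) q := by
  induction p generalizing n with
  | nil => simp [AvailFrom]
  | cons i p ih => simp [AvailFrom, ih, and_assoc, add_comm, add_left_comm]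

theorem AvailFrom.getElem {M : ℕ} {n : ℕ} {q : List (Instr M)} (h : AvailFrom n q) (i : ℕ)
    (hi : i < q.length) : (q[i]).Available (n + i) := by
  induction q generalizing n i with
  | nil => simp at hi
  | cons a q ih =>
    cases i with
    | zero => exact h.1
    | succ i =>
      have := ih h.2 i (by simpa using hi)
      rwa [show n + 1 + i = n + (i + 1) by ring] at this

/-- The values `v` satisfy the equations that the instructions `q`, placed at position `n`,
express. -/
def Models {M : ℕ} (x : Fin M → ℝ) (v : List ℝ) : ℕ → List (Instr M) → Prop
  | _, [] => True
  | n, i :: q => (Reg.tmp n).val x v = i.val x v ∧ Models x v (n + 1) q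

/-- Each instruction reads only earlier results, which later instructions leave unchanged. The final
list of results therefore satisfies all the defining equations at once, and values can be reasoned
about without tracking intermediate states. -/
theorem models_execute {M : ℕ} (x : Fin M → ℝ) (p q : List (Instr M))
    (h : AvailFrom p.length q) : Models x (execute x (p ++ q)) p.length q := by
  induction q generalizing p with
  | nil => trivial
  | cons i q ih =>
    have e : p ++ i :: q = (p ++ [i]) ++ q := by simp
    refine ⟨?_, ?_⟩
    · rw [Instr.val_execute_append x p _ h.1, e, Reg.val_execute_append x (p ++ [i]) q,
        execute_concat]
      · simp [Reg.val, ← length_execute x p]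
      · simp [Reg.Available]
    · have := ih (p ++ [i]) (by simpa using h.2)
      rw [e]
      simpa using this

/-! ### A program logic for building procedures -/

/-- After the program `p`, the operand `r` is available and holds the value `v`. -/
def Holds {M : ℕ} (x : Fin M → ℝ) (p : List (Instr M)) (r : Reg M) (v : ℝ) : Prop :=
  r.Available p.length ∧ r.val x (execute x p) = v

theorem Reg.Available.mono {M : ℕ} {r : Reg M} {m n : ℕ} (h : r.Available m) (hmn : m ≤ n) :
    r.Available n := by
  cases r with
  | inp i => trivial
  | tmp i => exact lt_of_lt_of_le h hmn

theorem Holds.append {M : ℕ} {x : Fin M → ℝ} {p : List (Instr M)} {r : Reg M} {v : ℝ}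
    (h : Holds x p r v) (q : List (Instr M)) : Holds x (p ++ q) r v :=
  ⟨h.1.mono (by simp), by rw [Reg.val_execute_append x p q h.1, h.2]⟩

theorem Holds.mono {M : ℕ} {x : Fin M → ℝ} {p p' : List (Instr M)} {r : Reg M} {v : ℝ}
    (h : Holds x p r v) (hp : p <+: p') : Holds x p' r v := by
  obtain ⟨q, rfl⟩ := hp
  exact h.append q

/-- After the program `p`, the pair of operands `z` holds the complex number `w`. -/
def CHolds {M : ℕ} (x : Fin M → ℝ) (p : List (Instr M)) (z : CReg M) (w : ℂ) : Prop :=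
  Holds x p z.re w.re ∧ Holds x p z.im w.im

theorem CHolds.mono {M : ℕ} {x : Fin M → ℝ} {p p' : List (Instr M)} {z : CReg M} {w : ℂ}
    (h : CHolds x p z w) (hp : p <+: p') : CHolds x p' z w :=
  ⟨h.1.mono hp, h.2.mono hp⟩

/-- Started after the program `p`, the procedure `b` appends `n` instructions, which only read
available results, and establishes `Q`. -/
def Spec {M : ℕ} {α : Type} (p : List (Instr M)) (b : Build M α) (n : ℕ)
    (Q : α → List (Instr M) → Prop) : Prop :=
  ∃ a q, b.run p = (a, p ++ q) ∧ q.length = n ∧ AvailFrom p.length q ∧ Q a (p ++ q)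

theorem Spec.pure {M : ℕ} {α : Type} {p : List (Instr M)} {a : α}
    {Q : α → List (Instr M) → Prop} (h : Q a p) : Spec p (pure a : Build M α) 0 Q :=
  ⟨a, [], by simp; rfl, rfl, trivial, by simpa using h⟩

theorem Spec.bind {M : ℕ} {α β : Type} {p : List (Instr M)} {b : Build M α} {f : α → Build M β}
    {n n' : ℕ} {Q : α → List (Instr M) → Prop} {Q' : β → List (Instr M) → Prop}
    (h : Spec p b n Q) (h' : ∀ a p', p <+: p' → Q a p' → Spec p' (f a) n' Q') :
    Spec p (b >>= f) (n + n') Q' := by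
  obtain ⟨a, q, hr, hl, ha, hQ⟩ := h
  obtain ⟨a', q', hr', hl', ha', hQ'⟩ := h' a (p ++ q) (List.prefix_append _ _) hQ
  refine ⟨a', q ++ q', ?_, by simp [hl, hl'], (availFrom_append _ _ _).2 ⟨ha, by simpa using ha'⟩,
    by simpa using hQ'⟩
  rw [StateT.run_bind, hr, ← List.append_assoc]
  exact hr'

theorem Spec.mono {M : ℕ} {α : Type} {p : List (Instr M)} {b : Build M α} {n n' : ℕ}
    {Q Q' : α → List (Instr M) → Prop} (h : Spec p b n Q) (hn : n = n')
    (hQ : ∀ a p', p <+: p' → Q a p' → Q' a p') : Spec p b n' Q' := by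
  obtain ⟨a, q, hr, hl, ha, h⟩ := h
  exact ⟨a, q, hr, hl.trans hn, ha, hQ _ _ (List.prefix_append _ _) h⟩

/-- Started after a program of length `L`, the procedure `b` appends `n` instructions, which only
read available results; if the values `w` satisfy their equations, then `Q` holds. -/
def Straight {M : ℕ} {α : Type} (x : Fin M → ℝ) (w : List ℝ) (L : ℕ) (b : Build M α) (n : ℕ)
    (Q : α → Prop) : Prop :=
  ∀ p, p.length = L → ∃ a q, b.run p = (a, p ++ q) ∧ q.length = n ∧ AvailFrom L q ∧
    (Models x w L q → Q a)

theorem Straight.pure {M : ℕ} {α : Type} {x : Fin M → ℝ} {w : List ℝ} {L : ℕ} {a : α}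
    {Q : α → Prop} (h : Q a) : Straight x w L (pure a) 0 Q :=
  fun p _ => ⟨a, [], by simp; rfl, rfl, trivial, fun _ => h⟩

/-- The equation of the new register becomes a premise of the postcondition. Since `w` is fixed
throughout, equations never have to be transported along the growing program; only availability
changes with `L`. -/
theorem Straight.emit_bind {M : ℕ} {α : Type} {x : Fin M → ℝ} {w : List ℝ} {L n : ℕ}
    {i : Instr M} {f : Reg M → Build M α} {Q : α → Prop} (hi : i.Available L)
    (h : ∀ r : Reg M, r.Available (L + 1) →
      Straight x w (L + 1) (f r) n fun a => r.val x w = i.val x w → Q a) :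
    Straight x w L (emit i >>= f) (n + 1) Q := by
  rintro p rfl
  obtain ⟨a, q, hr, hl, ha, hQ⟩ :=
    h (.tmp p.length) (Nat.lt_succ_self _) (p ++ [i]) (by simp)
  refine ⟨a, i :: q, ?_, by simp [hl], ⟨hi, ha⟩, fun hm => hQ hm.2 hm.1⟩
  rw [List.append_cons]
  exact hr

theorem Straight.add {M : ℕ} {α : Type} {x : Fin M → ℝ} {w : List ℝ} {L n : ℕ}
    {u v : Reg M} {f : Reg M → Build M α} {Q : α → Prop} (hu : u.Available L) (hv : v.Available L)
    (h : ∀ r : Reg M, r.Available (L + 1) →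
      Straight x w (L + 1) (f r) n fun a => r.val x w = u.val x w + v.val x w → Q a) :
    Straight x w L (emit (.add u v) >>= f) (n + 1) Q :=
  emit_bind ⟨hu, hv⟩ h

theorem Straight.sub {M : ℕ} {α : Type} {x : Fin M → ℝ} {w : List ℝ} {L n : ℕ}
    {u v : Reg M} {f : Reg M → Build M α} {Q : α → Prop} (hu : u.Available L) (hv : v.Available L)
    (h : ∀ r : Reg M, r.Available (L + 1) →
      Straight x w (L + 1) (f r) n fun a => r.val x w = u.val x w - v.val x w → Q a) :
    Straight x w L (emit (.sub u v) >>= f) (n + 1) Q :=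
  emit_bind ⟨hu, hv⟩ h

theorem Straight.mul {M : ℕ} {α : Type} {x : Fin M → ℝ} {w : List ℝ} {L n : ℕ}
    {c : ℝ} {u : Reg M} {f : Reg M → Build M α} {Q : α → Prop} (hu : u.Available L)
    (h : ∀ r : Reg M, r.Available (L + 1) →
      Straight x w (L + 1) (f r) n fun a => r.val x w = c * u.val x w → Q a) :
    Straight x w L (emit (.mul c u) >>= f) (n + 1) Q :=
  emit_bind (i := .mul c u) hu h

/-- The bridge from equational reasoning to `Spec`: whatever follows from the register equations
holds for the actual results, since those satisfy the equations. -/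
theorem Straight.spec {M : ℕ} {α : Type} (x : Fin M → ℝ) {p : List (Instr M)} {b : Build M α}
    {n : ℕ} {Q : α → List (Instr M) → Prop}
    (h : ∀ w, (∀ r v, Holds x p r v → r.val x w = v) → Straight x w p.length b n fun a =>
      ∀ p', (∀ r v, r.Available (p.length + n) → r.val x w = v → Holds x p' r v) → Q a p') :
    Spec p b n Q := by
  -- The emitted code does not depend on `w`, but it is needed to choose `w`. A first instance with
  -- a provisional `w` produces `q`; the second takes `w` to be the results of `p ++ q` and is then
  -- matched with the first.
  obtain ⟨a, q, hr, hl, ha, -⟩ := h (execute x p) (fun _ _ h => h.2) p rfl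
  obtain ⟨a', q', hr', -, -, hQ⟩ :=
    h (execute x (p ++ q)) (fun _ _ h => (h.append q).2) p rfl
  obtain ⟨rfl, hq⟩ := Prod.mk.inj (hr'.symm.trans hr)
  obtain rfl := List.append_cancel_left hq
  exact ⟨a', q', hr', hl, ha, hQ (models_execute x p q' ha) _
    fun _ _ h h' => ⟨by simpa [hl] using h, h'⟩⟩

theorem spec_emit {M : ℕ} (x : Fin M → ℝ) {p : List (Instr M)} {i : Instr M} {v : ℝ}
    (h : i.Available p.length) (hv : i.val x (execute x p) = v) :
    Spec p (emit i) 1 fun r p' => Holds x p' r v := by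
  refine ⟨Reg.tmp p.length, [i], rfl, rfl, ⟨h, trivial⟩, by simp [Reg.Available], ?_⟩
  rw [(models_execute x p [i] ⟨h, trivial⟩).1, Instr.val_execute_append x p _ h, hv]

theorem spec_add {M : ℕ} {x : Fin M → ℝ} {p : List (Instr M)} {a b : Reg M} {u v w : ℝ}
    (ha : Holds x p a u) (hb : Holds x p b v) (hw : u + v = w) :
    Spec p (emit (.add a b)) 1 fun r p' => Holds x p' r w :=
  spec_emit x ⟨ha.1, hb.1⟩ (by rw [Instr.val, ha.2, hb.2, hw])

theorem spec_sub {M : ℕ} {x : Fin M → ℝ} {p : List (Instr M)} {a b : Reg M} {u v w : ℝ}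
    (ha : Holds x p a u) (hb : Holds x p b v) (hw : u - v = w) :
    Spec p (emit (.sub a b)) 1 fun r p' => Holds x p' r w :=
  spec_emit x ⟨ha.1, hb.1⟩ (by rw [Instr.val, ha.2, hb.2, hw])

theorem spec_mul {M : ℕ} {x : Fin M → ℝ} {p : List (Instr M)} {c : ℝ} {a : Reg M} {u w : ℝ}
    (ha : Holds x p a u) (hw : c * u = w) :
    Spec p (emit (.mul c a)) 1 fun r p' => Holds x p' r w :=
  spec_emit x (i := .mul c a) ha.1 (by rw [Instr.val, ha.2, hw])

/-- `hQ` makes the results of one iteration survive the instructions of the later ones; each body is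
specified from an arbitrary extension of `p`. -/
theorem spec_forOneTo {M : ℕ} {α : Type} {p : List (Instr M)} (d : α) {body : ℕ → Build M α}
    {n c : ℕ} {Q : ℕ → α → List (Instr M) → Prop}
    (hQ : ∀ k a p' p'', p' <+: p'' → Q k a p' → Q k a p'')
    (h : ∀ k, 1 ≤ k → k ≤ n → ∀ p', p <+: p' → Spec p' (body k) c (Q k)) :
    Spec p (forOneTo d body n) (n * c) fun W p' => ∀ k, 1 ≤ k → k ≤ n → Q k (W k) p' := by
  induction n with
  | zero => rw [zero_mul]; exact Spec.pure fun k h₁ h₂ => by omega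
  | succ n ih =>
    refine Spec.mono (Spec.bind (ih fun k h₁ h₂ => h k h₁ (by omega)) fun W p₁ hp₁ hW =>
      Spec.bind (h (n + 1) (by omega) le_rfl p₁ hp₁) fun a p₂ hp₂ ha => Spec.pure ?_)
      (by ring) fun _ _ _ h => h
    intro k h₁ h₂
    rcases Nat.lt_or_ge n k with hk | hk
    · obtain rfl : k = n + 1 := by omega
      simpa using ha
    · rw [Function.update_of_ne (by omega)]
      exact hQ _ _ _ _ hp₂ (hW k h₁ hk)

/-! ## The steps of the transform -/

/-- The factors `ρ_j` of the step `k` of the transform of size `2 ^ m`. -/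
noncomputable def Scaling.rho : Scaling → ℕ → ℕ → ℕ → ℝ
  | .two, m, k, j => scaleFactor m k / scaleFactor (m + 1) j
  | _, _, _, _ => 1

/-- The factors `μ_j` of the step `k` of the transform of size `2 ^ m`. -/
noncomputable def Scaling.mu : Scaling → ℕ → ℕ → ℕ → ℝ
  | .four, m, k, j => scaleFactor m k / scaleFactor (m + 2) j
  | _, _, _, _ => 1

/-- The number of instructions of `stepZero`. -/
def Scaling.costZero : Scaling → ℕ
  | .one => 4
  | .two => 5
  | .four => 7

/-- The number of instructions of `stepEighth`. -/
def Scaling.costEighth : Scaling → ℕ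
  | .one => 6
  | .two => 8
  | .four => 10

/-- The number of instructions of `stepGeneral`. -/
def Scaling.costGeneral : Scaling → ℕ
  | .one => 20
  | .two => 24
  | .four => 28

theorem holds_data {M : ℕ} {x : Fin M → ℝ} {p : List (Instr M)} {w : List ℝ}
    (hin : ∀ r v, Holds x p r v → r.val x w = v) {r : Reg M} {v : ℝ} (h : Holds x p r v) :
    r.Available p.length ∧ r.val x w = v :=
  ⟨h.1, hin _ _ h⟩

open ComplexConjugate Complex in
-- Symbolic execution for arbitrary complex `U`, `V`, `Z`, `Z'`. No property of the Fourier
-- transform or of the scale factors enters here.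
theorem spec_stepGeneral {M : ℕ} {x : Fin M → ℝ} {p : List (Instr M)} (ℓ : Scaling) (m k : ℕ)
    {u v z z' : CReg M} {U V Z Z' S D t : ℂ} (hu : CHolds x p u U) (hv : CHolds x p v V)
    (hz : CHolds x p z Z) (hz' : CHolds x p z' Z')
    (ht : t = 1 - I * Real.tan (2 * Real.pi * k / 2 ^ m))
    (hS : S = t * Z + conj t * Z') (hD : D = t * Z - conj t * Z') :
    Spec p (stepGeneral ℓ m k u v z z') ℓ.costGeneral fun r p' =>
      CHolds x p' r.1 (ℓ.mu m k k * (U + ℓ.rho m k k * S)) ∧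
      CHolds x p' r.2.1 (ℓ.mu m k (k + 2 ^ m / 4) *
        (conj V - I * (ℓ.rho m k (k + 2 ^ m / 4) * D))) ∧
      CHolds x p' r.2.2.1 (ℓ.mu m k (2 ^ m / 4 - k) *
        (V - I * (ℓ.rho m k (k + 2 ^ m / 4) * conj D))) ∧
      CHolds x p' r.2.2.2 (ℓ.mu m k (2 * (2 ^ m / 4) - k) *
        (conj U - ℓ.rho m k k * conj S)) := by
  refine Straight.spec x fun w hin => ?_
  obtain ⟨hu1, hu1'⟩ := holds_data hin hu.1
  obtain ⟨hu2, hu2'⟩ := holds_data hin hu.2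
  obtain ⟨hv1, hv1'⟩ := holds_data hin hv.1
  obtain ⟨hv2, hv2'⟩ := holds_data hin hv.2
  obtain ⟨hz1, hz1'⟩ := holds_data hin hz.1
  obtain ⟨hz2, hz2'⟩ := holds_data hin hz.2
  obtain ⟨hy1, hy1'⟩ := holds_data hin hz'.1
  obtain ⟨hy2, hy2'⟩ := holds_data hin hz'.2
  clear hu hv hz hz' hin
  generalize p.length = L at *
  cases ℓ <;> (
    simp only [stepGeneral, cscale, bind_assoc, pure_bind, Scaling.costGeneral, Scaling.mu,
      Scaling.rho]
    -- Each pass consumes one instruction and records its register's availability and equation. The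
    -- last alternative closes the side goals that operands are available.
    repeat' first
      | with_reducible refine Straight.add ?_ ?_ fun _ _ => ?_
      | with_reducible refine Straight.sub ?_ ?_ fun _ _ => ?_
      | with_reducible refine Straight.mul ?_ fun _ _ => ?_
      | with_reducible refine Straight.pure ?_
      | with_reducible exact Reg.Available.mono ‹_› (by omega)
    intros
    rename_i hout
    refine ⟨⟨hout _ _ ?_ ?_, hout _ _ ?_ ?_⟩, ⟨hout _ _ ?_ ?_, hout _ _ ?_ ?_⟩,
      ⟨hout _ _ ?_ ?_, hout _ _ ?_ ?_⟩, ⟨hout _ _ ?_ ?_, hout _ _ ?_ ?_⟩⟩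
    all_goals first
      | with_reducible exact Reg.Available.mono ‹_› (by omega)
      | (clear hout
         simp only [*, mul_re, mul_im, add_re, add_im, sub_re, sub_im, conj_re, conj_im, I_re, I_im,
           ofReal_re, ofReal_im, one_re, one_im, map_sub, map_add, map_mul, map_one, conj_I,
           conj_ofReal, neg_re, neg_im]
         ring))

open Complex in
theorem spec_stepZero {M : ℕ} {x : Fin M → ℝ} {p : List (Instr M)} (ℓ : Scaling) (m : ℕ)
    {u0 u1 z z' : Reg M} {U0 U1 Z Z' : ℝ} (hu : Holds x p u0 U0) (hv : Holds x p u1 U1)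
    (hz : Holds x p z Z) (hz' : Holds x p z' Z') :
    Spec p (stepZero ℓ m u0 u1 z z') ℓ.costZero fun r p' =>
      Holds x p' r.1 (U0 + (Z + Z')) ∧
      CHolds x p' r.2.1 (match ℓ with
        | .one => U1 - I * (Z - Z')
        | .two => U1 - I * ((1 / scaleFactor (m + 1) (2 ^ m / 4) : ℝ) * (Z - Z'))
        | .four => (1 / scaleFactor (m + 2) (2 ^ m / 4) : ℝ) * (U1 - I * (Z - Z'))) ∧
      Holds x p' r.2.2 (match ℓ with
        | .one => U0 - (Z + Z')
        | .two => U0 - (Z + Z')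
        | .four => 1 / scaleFactor (m + 2) (2 ^ m / 2) * (U0 - (Z + Z'))) := by
  refine Straight.spec x fun w hin => ?_
  obtain ⟨hu, hu'⟩ := holds_data hin hu
  obtain ⟨hv, hv'⟩ := holds_data hin hv
  obtain ⟨hz, hw⟩ := holds_data hin hz
  obtain ⟨hz', hw'⟩ := holds_data hin hz'
  clear hin
  generalize p.length = L at *
  cases ℓ <;> (
    simp only [stepZero, cscale, bind_assoc, pure_bind, Scaling.costZero]
    repeat' first
      | with_reducible refine Straight.add ?_ ?_ fun _ _ => ?_
      | with_reducible refine Straight.sub ?_ ?_ fun _ _ => ?_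
      | with_reducible refine Straight.mul ?_ fun _ _ => ?_
      | with_reducible refine Straight.pure ?_
      | with_reducible exact Reg.Available.mono ‹_› (by omega)
    intros
    rename_i hout
    refine ⟨hout _ _ ?_ ?_, ⟨hout _ _ ?_ ?_, hout _ _ ?_ ?_⟩, hout _ _ ?_ ?_⟩
    all_goals first
      | with_reducible exact Reg.Available.mono ‹_› (by omega)
      | (clear hout
         simp only [*, mul_re, mul_im, sub_re, sub_im, I_re, I_im, ofReal_re, ofReal_im]
          <;> ring))

open ComplexConjugate Complex in
theorem spec_stepEighth {M : ℕ} {x : Fin M → ℝ} {p : List (Instr M)} (ℓ : Scaling) (m : ℕ)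
    {u : CReg M} {z z' : Reg M} {U : ℂ} {Z Z' : ℝ} (hu : CHolds x p u U)
    (hz : Holds x p z Z) (hz' : Holds x p z' Z') :
    Spec p (stepEighth ℓ m u z z') ℓ.costEighth fun r p' =>
      CHolds x p' r.1 (ℓ.mu m (2 ^ m / 8) (2 ^ m / 8) *
        (U + ℓ.rho m (2 ^ m / 8) (2 ^ m / 8) * ((1 - I) * Z + (1 + I) * Z'))) ∧
      CHolds x p' r.2 (ℓ.mu m (2 ^ m / 8) (2 ^ m / 8 + 2 ^ m / 4) *
        (conj U - ℓ.rho m (2 ^ m / 8) (2 ^ m / 8) * ((1 + I) * Z + (1 - I) * Z'))) := by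
  refine Straight.spec x fun w hin => ?_
  obtain ⟨hu1, hu1'⟩ := holds_data hin hu.1
  obtain ⟨hu2, hu2'⟩ := holds_data hin hu.2
  obtain ⟨hz, hw⟩ := holds_data hin hz
  obtain ⟨hz', hw'⟩ := holds_data hin hz'
  clear hin hu
  generalize p.length = L at *
  cases ℓ <;> (
    simp only [stepEighth, cscale, bind_assoc, pure_bind, Scaling.costEighth, Scaling.mu,
      Scaling.rho]
    repeat' first
      | with_reducible refine Straight.add ?_ ?_ fun _ _ => ?_
      | with_reducible refine Straight.sub ?_ ?_ fun _ _ => ?_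
      | with_reducible refine Straight.mul ?_ fun _ _ => ?_
      | with_reducible refine Straight.pure ?_
      | with_reducible exact Reg.Available.mono ‹_› (by omega)
    intros
    rename_i hout
    refine ⟨⟨hout _ _ ?_ ?_, hout _ _ ?_ ?_⟩, ⟨hout _ _ ?_ ?_, hout _ _ ?_ ?_⟩⟩
    all_goals first
      | with_reducible exact Reg.Available.mono ‹_› (by omega)
      | (clear hout
         simp only [*, mul_re, mul_im, add_re, add_im, sub_re, sub_im, I_re, I_im, conj_re, conj_im,
           ofReal_re, ofReal_im, one_re, one_im]
         ring))

/-! ## The scale factors -/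

theorem scaleFactor_add_three (m k : ℕ) :
    scaleFactor (m + 3) k =
      if k % 2 ^ (m + 1) ≤ 2 ^ m then scaleFactor (m + 1) (k % 2 ^ (m + 1)) *
        Real.cos (2 * Real.pi * (k % 2 ^ (m + 1) : ℕ) / 2 ^ (m + 3))
      else scaleFactor (m + 1) (k % 2 ^ (m + 1)) *
        Real.sin (2 * Real.pi * (k % 2 ^ (m + 1) : ℕ) / 2 ^ (m + 3)) := by
  rw [scaleFactor]

theorem scaleFactor_of_lt {m : ℕ} (hm : m < 3) (k : ℕ) : scaleFactor m k = 1 := by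
  interval_cases m <;> rw [scaleFactor]

theorem scaleFactor_pos (m k : ℕ) : 0 < scaleFactor m k := by
  induction m using Nat.strong_induction_on generalizing k with
  | _ m ih =>
    rcases lt_or_ge m 3 with hm | hm
    · simp [scaleFactor_of_lt hm]
    obtain ⟨m, rfl⟩ := Nat.exists_eq_add_of_le' hm
    rw [scaleFactor_add_three]
    set j := k % 2 ^ (m + 1) with hj
    have hlt : (j : ℝ) < 2 * 2 ^ m := by
      have : j < 2 ^ (m + 1) := Nat.mod_lt _ (by positivity)
      rw [pow_succ'] at this
      exact_mod_cast this
    have h2 : (0 : ℝ) < 2 ^ m := by positivity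
    have hang : 2 * Real.pi * (j : ℝ) / 2 ^ (m + 3) = Real.pi / 2 * (j / (2 * 2 ^ m)) := by
      rw [pow_add]; field_simp
    have hq : (j : ℝ) / (2 * 2 ^ m) < 1 := (div_lt_one (by positivity)).2 hlt
    have hpi := Real.pi_pos
    rw [hang]
    split_ifs with h
    · refine mul_pos (ih _ (by omega) _) (Real.cos_pos_of_mem_Ioo ⟨?_, ?_⟩)
      · have : 0 ≤ Real.pi / 2 * ((j : ℝ) / (2 * 2 ^ m)) := by positivity
        linarith
      · nlinarith
    · refine mul_pos (ih _ (by omega) _) (Real.sin_pos_of_pos_of_lt_pi ?_ ?_)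
      · have : 0 < j := by omega
        positivity
      · nlinarith

/-- After reduction modulo N/4 the two indices sum to 0 or N/4. In the second case the angles are
complementary, which exchanges the cosine and sine branches of the recursion; at N/8 both angles are
π/4, so the branches agree. Applied twice, this reflection also gives the period N/4. -/
theorem scaleFactor_symm {m j k : ℕ} (h : 2 ^ m ∣ 4 * (j + k)) :
    scaleFactor m j = scaleFactor m k := by
  induction m using Nat.strong_induction_on generalizing j k with
  | _ m ih =>
    rcases lt_or_ge m 3 with hm | hm
    · simp [scaleFactor_of_lt hm]
    obtain ⟨m, rfl⟩ := Nat.exists_eq_add_of_le' hm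
    have h2 : 0 < 2 ^ m := by positivity
    have hd : 2 ^ (m + 1) ∣ j + k := by
      rw [show 2 ^ (m + 3) = 4 * 2 ^ (m + 1) by ring] at h
      exact (Nat.mul_dvd_mul_iff_left (by norm_num)).1 h
    have hd' : 2 ^ (m + 1) ∣ j % 2 ^ (m + 1) + k % 2 ^ (m + 1) := by
      rw [Nat.dvd_iff_mod_eq_zero] at hd ⊢
      rwa [← Nat.add_mod]
    rw [scaleFactor_add_three, scaleFactor_add_three]
    have hj : j % 2 ^ (m + 1) < 2 ^ (m + 1) := Nat.mod_lt _ (by positivity)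
    have hk : k % 2 ^ (m + 1) < 2 ^ (m + 1) := Nat.mod_lt _ (by positivity)
    generalize j % 2 ^ (m + 1) = j at *
    generalize k % 2 ^ (m + 1) = k at *
    have hs := ih (m + 1) (by omega) (Dvd.dvd.mul_left hd' 4)
    obtain ⟨c, hc⟩ := hd'
    rw [pow_succ'] at hc hj hk
    -- Both residues are below N/4, so their sum is 0 or N/4.
    have hc2 : c < 2 := by
      by_contra hcon
      have : 2 * 2 ^ m * 2 ≤ 2 * 2 ^ m * c := Nat.mul_le_mul_left _ (by omega)
      omega
    have hang : j + k = 2 * 2 ^ m → 2 * Real.pi * (k : ℝ) / 2 ^ (m + 3) =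
        Real.pi / 2 - 2 * Real.pi * (j : ℝ) / 2 ^ (m + 3) := by
      intro h
      have : (k : ℝ) = 2 * 2 ^ m - j := by
        rw [eq_sub_iff_add_eq']
        exact_mod_cast h
      rw [this, pow_add]
      field_simp
    interval_cases c
    · obtain ⟨rfl, rfl⟩ : j = 0 ∧ k = 0 := by omega
      rfl
    · rw [mul_one] at hc
      rw [hang hc, hs, Real.cos_pi_div_two_sub, Real.sin_pi_div_two_sub]
      rcases lt_trichotomy j (2 ^ m) with hlt | heq | hgt
      · rw [if_pos (by omega), if_neg (by omega)]
      · have e : 2 * Real.pi * (j : ℝ) / 2 ^ (m + 3) = Real.pi / 4 := by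
          rw [heq, pow_add]
          push_cast
          field_simp
          norm_num
        rw [if_pos (by omega), if_pos (by omega), e, Real.cos_pi_div_four, Real.sin_pi_div_four]
      · rw [if_neg (by omega), if_pos (by omega)]

theorem scaleFactor_zero_right (m : ℕ) : scaleFactor m 0 = 1 := by
  induction m using Nat.strong_induction_on with
  | _ m ih =>
    rcases lt_or_ge m 3 with hm | hm
    · exact scaleFactor_of_lt hm 0
    obtain ⟨m, rfl⟩ := Nat.exists_eq_add_of_le' hm
    simp [scaleFactor_add_three, ih (m + 1) (by omega)]

theorem scaleFactor_eq_one {m k : ℕ} (h : 2 ^ m ∣ 4 * k) : scaleFactor m k = 1 := by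
  rw [scaleFactor_symm (k := 0) (by simpa using h), scaleFactor_zero_right]

open Complex in
/-- The twiddle factor `t_{N,k} = ω_N^k s_{N/4,k} / s_{N,k}` equals `1 - i tan(2πk/N)`. -/
theorem scaleFactor_mul_twiddle {m k : ℕ} (hk : k ≤ 2 ^ m) :
    (scaleFactor (m + 3) k : ℂ) * (1 - I * Real.tan (2 * Real.pi * k / 2 ^ (m + 3))) =
      scaleFactor (m + 1) k * exp (-(2 * Real.pi * I * k / 2 ^ (m + 3))) := by
  have hk' : k % 2 ^ (m + 1) = k := Nat.mod_eq_of_lt (by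
    have := Nat.two_pow_pos m
    rw [pow_succ']
    omega)
  have hpos := scaleFactor_pos (m + 3) k
  rw [scaleFactor_add_three, hk', if_pos hk] at hpos ⊢
  set θ := 2 * Real.pi * k / 2 ^ (m + 3) with hθ
  have e : -(2 * Real.pi * I * k / 2 ^ (m + 3) : ℂ) = -(θ : ℝ) * I := by
    rw [hθ]; push_cast; ring
  have hc : Real.cos θ ≠ 0 := fun h => by simp [h] at hpos
  have hc' : (Real.cos θ : ℂ) ≠ 0 := by exact_mod_cast hc
  rw [e, exp_mul_I, cos_neg, sin_neg, Real.tan_eq_sin_div_cos, ofReal_div, ← ofReal_cos,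
    ← ofReal_sin]
  push_cast at hc' ⊢
  field_simp
  ring

section

/-! ## The discrete Fourier transform of size `2 ^ m` -/

open Complex ComplexConjugate

/-- The `k`-th output of the DFT of size `2 ^ m` of real data. -/
noncomputable def powDFT (m : ℕ) (y : ℕ → ℝ) (k : ℤ) : ℂ :=
  ∑ n ∈ Finset.range (2 ^ m), y n * exp (-(2 * Real.pi * I * (n * k) / 2 ^ m))

theorem exp_two_pi_div_pow_eq {m : ℕ} {a b : ℤ} (h : (2 ^ m : ℤ) ∣ a - b) :
    exp (-(2 * Real.pi * I * a / 2 ^ m)) = exp (-(2 * Real.pi * I * b / 2 ^ m)) := by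
  obtain ⟨c, hc⟩ := h
  rw [exp_eq_exp_iff_exists_int]
  refine ⟨-c, ?_⟩
  have : (a : ℂ) = b + 2 ^ m * c := by
    rw [← sub_eq_iff_eq_add']
    exact_mod_cast hc
  rw [this]
  push_cast
  field_simp
  ring

theorem powDFT_periodic (m : ℕ) (y : ℕ → ℝ) {k l : ℤ} (h : (2 ^ m : ℤ) ∣ k - l) :
    powDFT m y k = powDFT m y l := by
  refine Finset.sum_congr rfl fun n _ => ?_
  have := exp_two_pi_div_pow_eq (m := m) (a := n * k) (b := n * l)
    (by rw [← mul_sub]; exact Dvd.dvd.mul_left h _)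
  push_cast at this
  rw [this]

theorem conj_powDFT (m : ℕ) (y : ℕ → ℝ) (k : ℤ) : conj (powDFT m y k) = powDFT m y (-k) := by
  rw [powDFT, powDFT, map_sum]
  refine Finset.sum_congr rfl fun n _ => ?_
  rw [map_mul, conj_ofReal, ← exp_conj]
  congr 2
  simp [map_ofNat]

/-- Conjugation negates the frequency, and k ≡ -k modulo N exactly when N divides 2k. -/
theorem powDFT_im_eq_zero (m : ℕ) (y : ℕ → ℝ) {k : ℤ} (h : (2 ^ m : ℤ) ∣ 2 * k) :
    (powDFT m y k).im = 0 := by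
  rw [← conj_eq_iff_im, conj_powDFT]
  exact powDFT_periodic m y ((dvd_neg.2 h).trans ⟨1, by ring⟩)

theorem ofReal_re_powDFT (m : ℕ) (y : ℕ → ℝ) {k : ℤ} (h : (2 ^ m : ℤ) ∣ 2 * k) :
    ((powDFT m y k).re : ℂ) = powDFT m y k :=
  Complex.ext rfl (by rw [ofReal_im, powDFT_im_eq_zero m y h])

theorem sum_range_four_mul {A : Type*} [AddCommMonoid A] (f : ℕ → A) (h : ℕ) :
    ∑ n ∈ Finset.range (4 * h), f n = ∑ n ∈ Finset.range (2 * h), f (2 * n) +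
      (∑ n ∈ Finset.range h, f (4 * n + 1) + ∑ n ∈ Finset.range h, f (4 * n + 3)) := by
  induction h with
  | zero => simp
  | succ h ih =>
    simp only [mul_add, mul_one, Finset.sum_range_succ, ih, Finset.sum_range_succ]
    rw [show 2 * (2 * h) = 4 * h by ring]
    abel

/-- A cyclic rotation of the summands, used to replace the indices 4n+3 by 4n-1 modulo N. -/
theorem sum_range_shift {A : Type*} [AddCommMonoid A] {f g : ℕ → A} {h : ℕ} (hh : 0 < h)
    (h0 : g 0 = f (h - 1)) (hs : ∀ n, n + 1 < h → g (n + 1) = f n) :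
    ∑ n ∈ Finset.range h, g n = ∑ n ∈ Finset.range h, f n := by
  obtain ⟨h, rfl⟩ := Nat.exists_eq_add_of_le' hh
  rw [Finset.sum_range_succ', Finset.sum_range_succ, h0]
  congr 1
  exact Finset.sum_congr rfl fun n hn => hs n (by simpa using hn)

/-- The conjugate-pair split-radix decomposition. -/
theorem powDFT_split (m : ℕ) (y : ℕ → ℝ) (k : ℤ) :
    powDFT (m + 2) y k = powDFT (m + 1) (fun n => y (2 * n)) k +
      (exp (-(2 * Real.pi * I * k / 2 ^ (m + 2))) * powDFT m (fun n => y (4 * n + 1)) k +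
        exp (2 * Real.pi * I * k / 2 ^ (m + 2)) *
          powDFT m (fun n => y ((4 * n + (2 ^ (m + 2) - 1)) % 2 ^ (m + 2))) k) := by
  have h4 : 2 ^ (m + 2) = 4 * 2 ^ m := by ring
  have hp := Nat.two_pow_pos m
  rw [powDFT, h4, sum_range_four_mul, powDFT, powDFT, powDFT, Finset.mul_sum, Finset.mul_sum,
    show 2 * 2 ^ m = 2 ^ (m + 1) by ring]
  congr 1
  · refine Finset.sum_congr rfl fun n _ => ?_
    congr 2
    rw [pow_succ, pow_succ]
    push_cast
    field_simp
  congr 1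
  · refine Finset.sum_congr rfl fun n _ => ?_
    rw [mul_left_comm (exp _), ← exp_add]
    congr 2
    rw [pow_add]
    push_cast
    field_simp
    ring
  · symm
    refine sum_range_shift hp ?_ fun n hn => ?_
    · rw [mul_left_comm (exp _), ← exp_add]
      have e : (4 * 0 + (4 * 2 ^ m - 1)) % (4 * 2 ^ m) = 4 * (2 ^ m - 1) + 3 := by
        rw [Nat.mod_eq_of_lt] <;> omega
      rw [e]
      congr 1
      -- The term n = 0 sits at the entry N-1 ≡ -1, so the exponents -k and (N-1)k must agree modulo
      -- N.
      have := exp_two_pi_div_pow_eq (m := m + 2) (a := -k)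
        (b := ((4 * (2 ^ m - 1) + 3 : ℕ) : ℤ) * k) ⟨-k, by
          rw [show 4 * (2 ^ m - 1) + 3 = 4 * 2 ^ m - 1 by omega, Nat.cast_sub (by omega)]
          push_cast
          ring⟩
      push_cast at this ⊢
      rw [← this]
      congr 1
      ring
    · rw [mul_left_comm (exp _), ← exp_add]
      have e : (4 * (n + 1) + (4 * 2 ^ m - 1)) % (4 * 2 ^ m) = 4 * n + 3 := by
        rw [show 4 * (n + 1) + (4 * 2 ^ m - 1) = 4 * n + 3 + 4 * 2 ^ m by omega,
          Nat.add_mod_right, Nat.mod_eq_of_lt]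
        omega
      rw [e]
      congr 2
      rw [pow_add]
      push_cast
      field_simp
      ring

/-! ## The steps compute the discrete Fourier transform -/

/-- Apply the split at each of the four frequencies. Periodicity and the conjugate symmetry of real
data reduce `U`, `Z`, `Z'` to the indices k and N/4-k, while the twiddle factor w becomes -iw, -i
conj w or -conj w. -/
theorem powDFT_butterfly (m : ℕ) (y : ℕ → ℝ) (k : ℤ) {U Z Z' : ℤ → ℂ} {w S D : ℂ}
    (hU : U = powDFT (m + 1) fun n => y (2 * n))
    (hZ : Z = powDFT m fun n => y (4 * n + 1))
    (hZ' : Z' = powDFT m fun n => y ((4 * n + (2 ^ (m + 2) - 1)) % 2 ^ (m + 2)))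
    (hw : w = exp (-(2 * Real.pi * I * k / 2 ^ (m + 2))))
    (hS : S = w * Z k + conj w * Z' k) (hD : D = w * Z k - conj w * Z' k) :
    powDFT (m + 2) y k = U k + S ∧
    powDFT (m + 2) y (k + 2 ^ m) = conj (U (2 ^ m - k)) - I * D ∧
    powDFT (m + 2) y (2 ^ m - k) = U (2 ^ m - k) - I * conj D ∧
    powDFT (m + 2) y (2 * 2 ^ m - k) = conj (U k) - conj S := by
  have hcw : conj w = exp (2 * Real.pi * I * k / 2 ^ (m + 2)) := by
    rw [hw, ← exp_conj]
    congr 1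
    simp [map_ofNat]
    ring
  have hI : exp (2 * Real.pi * I / 4) = I := by
    rw [show 2 * Real.pi * I / 4 = Real.pi / 2 * I by ring, exp_pi_div_two_mul_I]
  have hmI : exp (-(2 * Real.pi * I / 4)) = -I := by
    rw [exp_neg, hI, inv_I]
  have hpi : exp (Real.pi * I) = -1 := exp_pi_mul_I
  have hmpi : exp (-(Real.pi * I)) = -1 := by rw [exp_neg, hpi]; norm_num
  have hcast : ((2 : ℂ) ^ (m + 2)) = 4 * 2 ^ m := by ring
  have cU : ∀ k l : ℤ, (2 ^ (m + 1) : ℤ) ∣ k + l → U k = conj (U l) := fun k l h => by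
    rw [hU, conj_powDFT, powDFT_periodic _ _ (l := -l) (by simpa using h)]
  have cZ : ∀ k l : ℤ, (2 ^ m : ℤ) ∣ k + l → Z k = conj (Z l) := fun k l h => by
    rw [hZ, conj_powDFT, powDFT_periodic _ _ (l := -l) (by simpa using h)]
  have cZ' : ∀ k l : ℤ, (2 ^ m : ℤ) ∣ k + l → Z' k = conj (Z' l) := fun k l h => by
    rw [hZ', conj_powDFT, powDFT_periodic _ _ (l := -l) (by simpa using h)]
  have key := powDFT_split m y
  rw [← hU, ← hZ, ← hZ'] at key
  refine ⟨?_, ?_, ?_, ?_⟩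
  · rw [key, hS, hcw, ← hw]
  · rw [key, cU (k + 2 ^ m) (2 ^ m - k) ⟨1, by ring⟩, cZ (k + 2 ^ m) (-k) ⟨1, by ring⟩,
      cZ' (k + 2 ^ m) (-k) ⟨1, by ring⟩, ← cZ k (-k) ⟨0, by ring⟩, ← cZ' k (-k) ⟨0, by ring⟩, hD]
    have e1 : exp (2 * Real.pi * I * ((k + 2 ^ m : ℤ) : ℂ) / 2 ^ (m + 2)) = conj w * I := by
      refine Eq.trans ?_ (congrArg (conj w * ·) hI)
      rw [hcw, ← exp_add, hcast]
      congr 1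
      push_cast
      field_simp
    have e3 : exp (-(2 * Real.pi * I * ((k + 2 ^ m : ℤ) : ℂ) / 2 ^ (m + 2))) = w * -I := by
      rw [hw, ← hmI, ← exp_add, hcast]
      congr 1
      push_cast
      field_simp
      ring
    rw [e1, e3]
    ring
  · rw [key, cZ (2 ^ m - k) k ⟨1, by ring⟩, cZ' (2 ^ m - k) k ⟨1, by ring⟩, hD]
    have e1 : exp (2 * Real.pi * I * ((2 ^ m - k : ℤ) : ℂ) / 2 ^ (m + 2)) = w * I := by
      refine Eq.trans ?_ (congrArg (w * ·) hI)
      rw [hw, ← exp_add, hcast]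
      congr 1
      push_cast
      field_simp
      ring
    have e3 : exp (-(2 * Real.pi * I * ((2 ^ m - k : ℤ) : ℂ) / 2 ^ (m + 2))) = conj w * -I := by
      rw [hcw, ← hmI, ← exp_add, hcast]
      congr 1
      push_cast
      field_simp
      ring
    rw [e1, e3, map_sub, map_mul, map_mul, conj_conj]
    ring
  · rw [key, cU (2 * 2 ^ m - k) k ⟨1, by ring⟩, cZ (2 * 2 ^ m - k) k ⟨2, by ring⟩,
      cZ' (2 * 2 ^ m - k) k ⟨2, by ring⟩, hS]
    have e1 : exp (2 * Real.pi * I * ((2 * 2 ^ m - k : ℤ) : ℂ) / 2 ^ (m + 2)) = w * -1 := by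
      rw [hw, ← hpi, ← exp_add, hcast]
      congr 1
      push_cast
      field_simp
      ring
    have e3 : exp (-(2 * Real.pi * I * ((2 * 2 ^ m - k : ℤ) : ℂ) / 2 ^ (m + 2))) =
        conj w * -1 := by
      rw [hcw, ← hmpi, ← exp_add, hcast]
      congr 1
      push_cast
      field_simp
      ring
    rw [e1, e3, map_add, map_mul, map_mul, conj_conj]
    ring

/-- `log₂ ℓ`, so that `scaleFactor (m + ℓ.shift) k` is the scale factor `s_{ℓN,k}` for
`N = 2 ^ m`. -/
def Scaling.shift : Scaling → ℕ
  | .one => 0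
  | .two => 1
  | .four => 2

/-- Combining a half-size output scaled by `s_{ℓ'N/2,u}` with a part scaled by `s_{N,k}` gives an
output scaled by `s_{ℓN,j}`. -/
theorem mu_mul_add_rho_mul (ℓ : Scaling) {m k u i j : ℕ}
    (hu : scaleFactor (m + 1) u = scaleFactor (m + 1) k)
    (hj : scaleFactor (m + 1) j = scaleFactor (m + 1) k)
    (hu' : scaleFactor (m + 2) u = scaleFactor (m + 2) j)
    (hi : scaleFactor (m + 2) i = scaleFactor (m + 2) j) (A B c : ℂ) :
    ℓ.mu (m + 1) k j * (A / scaleFactor (m + ℓ.sub.shift) u +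
      c * (ℓ.rho (m + 1) k i * (B / scaleFactor (m + 1) k))) =
    (A + c * B) / scaleFactor (m + 1 + ℓ.shift) j := by
  have h1 : (scaleFactor (m + 1) k : ℂ) ≠ 0 := by exact_mod_cast (scaleFactor_pos _ _).ne'
  have h2 : (scaleFactor (m + 2) j : ℂ) ≠ 0 := by exact_mod_cast (scaleFactor_pos _ _).ne'
  have h3 : (scaleFactor (m + 3) j : ℂ) ≠ 0 := by exact_mod_cast (scaleFactor_pos _ _).ne'
  cases ℓ <;> simp only [Scaling.mu, Scaling.rho, Scaling.sub, Scaling.shift, hu, hj, hu', hi,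
    add_assoc, Nat.reduceAdd, add_zero] <;> push_cast <;> field_simp

theorem spec_stepZero_powDFT {M : ℕ} {x : Fin M → ℝ} {p : List (Instr M)} (ℓ : Scaling) (m : ℕ)
    (y : ℕ → ℝ) {u0 u1 z z' : Reg M}
    (hu : Holds x p u0 (powDFT (m + 1) (fun n => y (2 * n)) 0).re)
    (hv : Holds x p u1 ((powDFT (m + 1) (fun n => y (2 * n)) (2 ^ m : ℕ)).re /
      scaleFactor (m + 1 + ℓ.sub.shift) (2 ^ m)))
    (hz : Holds x p z (powDFT m (fun n => y (4 * n + 1)) 0).re)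
    (hz' : Holds x p z'
      (powDFT m (fun n => y ((4 * n + (2 ^ (m + 2) - 1)) % 2 ^ (m + 2))) 0).re) :
    Spec p (stepZero ℓ (m + 2) u0 u1 z z') ℓ.costZero fun r p' =>
      Holds x p' r.1 (powDFT (m + 2) y 0).re ∧
      CHolds x p' r.2.1 (powDFT (m + 2) y (2 ^ m : ℕ) / scaleFactor (m + 2 + ℓ.shift) (2 ^ m)) ∧
      Holds x p' r.2.2 ((powDFT (m + 2) y (2 * 2 ^ m : ℕ)).re /
        scaleFactor (m + 2 + ℓ.shift) (2 * 2 ^ m)) := by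
  refine (spec_stepZero ℓ (m + 2) hu hv hz hz').mono rfl fun r p' _ h => ?_
  obtain ⟨h0, h1, -, h2⟩ := powDFT_butterfly m y 0 rfl rfl rfl rfl rfl rfl
  simp only [Int.cast_zero, mul_zero, zero_div, neg_zero, exp_zero, map_one, one_mul, zero_add,
    sub_zero] at h0 h1 h2
  have r0 : ∀ m y, powDFT m y 0 = (powDFT m y 0).re := fun m y =>
    (ofReal_re_powDFT m y (by simp)).symm
  have r1 : ∀ y, powDFT (m + 1) y (2 ^ m : ℕ) = (powDFT (m + 1) y (2 ^ m : ℕ)).re := fun y =>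
    (ofReal_re_powDFT _ _ ⟨1, by push_cast; ring⟩).symm
  rw [r0 m fun n => y (4 * n + 1), r0 m fun n => y ((4 * n + _) % _)] at h1
  have e4 : 2 ^ (m + 2) / 4 = 2 ^ m := by rw [pow_add]; simp
  have e2 : 2 ^ (m + 2) / 2 = 2 * 2 ^ m := by rw [pow_add]; omega
  rw [e2, e4] at h
  push_cast at r1 h ⊢
  rw [r1, conj_ofReal] at h1
  rw [h0, h1, h2]
  -- With N = 2^(m+2), the factors s_{N,N/4}, s_{N,N/2} and s_{2N,N/2} are trivial because the index
  -- is a multiple of a quarter of the size. The remaining s_{2N,N/4}, s_{4N,N/4} and s_{4N,N/2} are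
  -- the ones that cost multiplications for the scalings 2 and 4.
  have s1 : scaleFactor (m + 2) (2 ^ m) = 1 := scaleFactor_eq_one ⟨1, by ring⟩
  have s2 : scaleFactor (m + 2) (2 * 2 ^ m) = 1 := scaleFactor_eq_one ⟨2, by ring⟩
  have s3 : scaleFactor (m + 3) (2 * 2 ^ m) = 1 := scaleFactor_eq_one ⟨1, by ring⟩
  have s4 : (scaleFactor (m + 3) (2 ^ m) : ℂ) ≠ 0 := by exact_mod_cast (scaleFactor_pos _ _).ne'
  have s5 : (scaleFactor (m + 4) (2 ^ m) : ℂ) ≠ 0 := by exact_mod_cast (scaleFactor_pos _ _).ne'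
  refine ⟨?_, ?_, ?_⟩
  · simpa using h.1
  · convert h.2.1 using 1
    cases ℓ <;> simp only [Scaling.sub, Scaling.shift, add_assoc, Nat.reduceAdd, add_zero, s1,
      ofReal_one, div_one]
    · field_simp
    · field_simp
  · convert h.2.2 using 1
    cases ℓ <;> simp [Scaling.shift, s2, s3, add_assoc, div_eq_inv_mul]

/-- The gain of the rescaling: a twiddle factor with real part 1 needs only two real
multiplications, and the missing cosine is moved into the scale factor of the result. -/
theorem twiddle_mul_div {m k : ℕ} (hk : k ≤ 2 ^ m) {t w : ℂ}
    (ht : t = 1 - I * Real.tan (2 * Real.pi * k / 2 ^ (m + 3)))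
    (hw : w = exp (-(2 * Real.pi * I * k / 2 ^ (m + 3)))) (Z : ℂ) :
    t * (Z / scaleFactor (m + 1) k) = w * Z / scaleFactor (m + 3) k ∧
    conj t * (Z / scaleFactor (m + 1) k) = conj w * Z / scaleFactor (m + 3) k := by
  have h := scaleFactor_mul_twiddle hk
  rw [← ht, ← hw] at h
  have h' := congrArg conj h
  rw [map_mul, map_mul, conj_ofReal, conj_ofReal] at h'
  have h1 : (scaleFactor (m + 1) k : ℂ) ≠ 0 := by exact_mod_cast (scaleFactor_pos _ _).ne'
  have h3 : (scaleFactor (m + 3) k : ℂ) ≠ 0 := by exact_mod_cast (scaleFactor_pos _ _).ne'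
  constructor
  · field_simp
    linear_combination Z * h
  · field_simp
    linear_combination Z * h'

theorem spec_stepGeneral_powDFT {M : ℕ} {x : Fin M → ℝ} {p : List (Instr M)} (ℓ : Scaling)
    {m k : ℕ} (hk : k ≤ 2 ^ m) (y : ℕ → ℝ) {u v z z' : CReg M}
    (hu : CHolds x p u (powDFT (m + 2) (fun n => y (2 * n)) k /
      scaleFactor (m + 2 + ℓ.sub.shift) k))
    (hv : CHolds x p v (powDFT (m + 2) (fun n => y (2 * n)) (2 * 2 ^ m - k : ℕ) /
      scaleFactor (m + 2 + ℓ.sub.shift) (2 * 2 ^ m - k)))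
    (hz : CHolds x p z (powDFT (m + 1) (fun n => y (4 * n + 1)) k / scaleFactor (m + 1) k))
    (hz' : CHolds x p z'
      (powDFT (m + 1) (fun n => y ((4 * n + (2 ^ (m + 3) - 1)) % 2 ^ (m + 3))) k /
        scaleFactor (m + 1) k)) :
    Spec p (stepGeneral ℓ (m + 3) k u v z z') ℓ.costGeneral fun r p' =>
      CHolds x p' r.1 (powDFT (m + 3) y k / scaleFactor (m + 3 + ℓ.shift) k) ∧
      CHolds x p' r.2.1 (powDFT (m + 3) y (k + 2 * 2 ^ m : ℕ) /
        scaleFactor (m + 3 + ℓ.shift) (k + 2 * 2 ^ m)) ∧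
      CHolds x p' r.2.2.1 (powDFT (m + 3) y (2 * 2 ^ m - k : ℕ) /
        scaleFactor (m + 3 + ℓ.shift) (2 * 2 ^ m - k)) ∧
      CHolds x p' r.2.2.2 (powDFT (m + 3) y (4 * 2 ^ m - k : ℕ) /
        scaleFactor (m + 3 + ℓ.shift) (4 * 2 ^ m - k)) := by
  refine (spec_stepGeneral ℓ (m + 3) k hu hv hz hz' rfl rfl rfl).mono rfl fun r p' _ h => ?_
  have hz := twiddle_mul_div hk rfl rfl (powDFT (m + 1) (fun n => y (4 * n + 1)) k)
  have hz' := twiddle_mul_div hk rfl rfl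
    (powDFT (m + 1) (fun n => y ((4 * n + (2 ^ (m + 3) - 1)) % 2 ^ (m + 3))) k)
  have e4 : 2 ^ (m + 3) / 4 = 2 * 2 ^ m := by rw [pow_add]; omega
  have ez : (2 : ℤ) ^ (m + 1) = 2 * 2 ^ m := by ring
  rw [hz.1, hz'.2, ← add_div, ← sub_div, e4, map_div₀, map_div₀, map_div₀, map_div₀, conj_ofReal,
    conj_ofReal, conj_ofReal, ← mul_assoc 2 2 (2 ^ m)] at h
  obtain ⟨h0, h1, h2, h3⟩ := powDFT_butterfly (m + 1) y k rfl rfl rfl rfl rfl rfl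
  rw [ez, ← mul_assoc, show (2 : ℤ) * 2 = 4 by norm_num] at h3
  rw [ez] at h1 h2
  simp only [Int.cast_natCast] at h0 h1 h2 h3
  have hl : k ≤ 2 * 2 ^ m := by omega
  have hl' : k ≤ 4 * 2 ^ m := by omega
  push_cast [hl, hl'] at h ⊢
  rw [h0, h1, h2, h3]
  -- With N = 2^(m+3), `sy` reflects the index of s_N when j+l is a multiple of N/4, and `sy'` that
  -- of s_{2N} when j+l is a multiple of N/2.
  have sy : ∀ {j l : ℕ} (c : ℕ), j + l = c * (2 * 2 ^ m) →
      scaleFactor (m + 3) j = scaleFactor (m + 3) l :=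
    fun c h => scaleFactor_symm ⟨c, by rw [h]; ring⟩
  have sy' : ∀ {j l : ℕ} (c : ℕ), j + l = c * (4 * 2 ^ m) →
      scaleFactor (m + 4) j = scaleFactor (m + 4) l :=
    fun c h => scaleFactor_symm ⟨c, by rw [h]; ring⟩
  refine ⟨?_, ?_, ?_, ?_⟩
  · convert h.1 using 1
    have := mu_mul_add_rho_mul ℓ (m := m + 2) (k := k) (u := k) (i := k) (j := k) rfl rfl rfl rfl
    simpa only [one_mul] using (this _ _ 1).symm
  · convert h.2.1 using 1
    -- The shift of s_N by N/4 is the composite of two reflections, k+N/4 ↦ N/4-k ↦ k.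
    have := mu_mul_add_rho_mul ℓ (m := m + 2) (k := k) (u := 2 * 2 ^ m - k) (i := k + 2 * 2 ^ m)
      (j := k + 2 * 2 ^ m) (sy 1 (by omega))
      ((sy (l := 2 * 2 ^ m - k) 2 (by omega)).trans (sy 1 (by omega))) (sy' 1 (by omega)) rfl
    simpa only [neg_mul, ← sub_eq_add_neg] using (this _ _ (-I)).symm
  · convert h.2.2.1 using 1
    have := mu_mul_add_rho_mul ℓ (m := m + 2) (k := k) (u := 2 * 2 ^ m - k) (i := k + 2 * 2 ^ m)
      (j := 2 * 2 ^ m - k) (sy 1 (by omega)) (sy 1 (by omega)) rfl (sy' 1 (by omega))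
    simpa only [neg_mul, ← sub_eq_add_neg] using (this _ _ (-I)).symm
  · convert h.2.2.2 using 1
    have := mu_mul_add_rho_mul ℓ (m := m + 2) (k := k) (u := k) (i := k)
      (j := 4 * 2 ^ m - k) rfl (sy 2 (by omega)) (sy' 1 (by omega)) (sy' 1 (by omega))
    simpa only [neg_mul, one_mul, ← sub_eq_add_neg] using (this _ _ (-1)).symm

theorem spec_stepEighth_powDFT {M : ℕ} {x : Fin M → ℝ} {p : List (Instr M)} (ℓ : Scaling)
    (m : ℕ) (y : ℕ → ℝ) {u : CReg M} {z z' : Reg M}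
    (hu : CHolds x p u (powDFT (m + 2) (fun n => y (2 * n)) (2 ^ m : ℕ) /
      scaleFactor (m + 2 + ℓ.sub.shift) (2 ^ m)))
    (hz : Holds x p z ((powDFT (m + 1) (fun n => y (4 * n + 1)) (2 ^ m : ℕ)).re /
      scaleFactor (m + 1) (2 ^ m)))
    (hz' : Holds x p z' ((powDFT (m + 1)
      (fun n => y ((4 * n + (2 ^ (m + 3) - 1)) % 2 ^ (m + 3))) (2 ^ m : ℕ)).re /
      scaleFactor (m + 1) (2 ^ m))) :
    Spec p (stepEighth ℓ (m + 3) u z z') ℓ.costEighth fun r p' =>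
      CHolds x p' r.1 (powDFT (m + 3) y (2 ^ m : ℕ) / scaleFactor (m + 3 + ℓ.shift) (2 ^ m)) ∧
      CHolds x p' r.2 (powDFT (m + 3) y (3 * 2 ^ m : ℕ) /
        scaleFactor (m + 3 + ℓ.shift) (3 * 2 ^ m)) := by
  refine (spec_stepEighth ℓ (m + 3) hu hz hz').mono rfl fun r p' _ h => ?_
  have ht : (1 - I : ℂ) = 1 - I * Real.tan (2 * Real.pi * (2 ^ m : ℕ) / 2 ^ (m + 3)) := by
    have : 2 * Real.pi * (2 ^ m : ℕ) / 2 ^ (m + 3) = Real.pi / 4 := by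
      rw [pow_add]
      push_cast
      field_simp
      norm_num
    rw [this, Real.tan_pi_div_four, ofReal_one, mul_one]
  have hc : conj (1 - I) = 1 + I := by simp
  have r1 : ∀ y, ((powDFT (m + 1) y (2 ^ m : ℕ)).re : ℂ) = powDFT (m + 1) y (2 ^ m : ℕ) :=
    fun y => ofReal_re_powDFT _ _ ⟨1, by push_cast; ring⟩
  have hz := twiddle_mul_div le_rfl ht rfl (powDFT (m + 1) (fun n => y (4 * n + 1)) (2 ^ m : ℕ))
  have hz' := twiddle_mul_div le_rfl ht rfl
    (powDFT (m + 1) (fun n => y ((4 * n + (2 ^ (m + 3) - 1)) % 2 ^ (m + 3))) (2 ^ m : ℕ))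
  rw [hc] at hz hz'
  have e8 : 2 ^ (m + 3) / 8 = 2 ^ m := by rw [pow_add]; omega
  have e4 : 2 ^ (m + 3) / 4 = 2 * 2 ^ m := by rw [pow_add]; omega
  have e3 : 2 ^ m + 2 * 2 ^ m = 3 * 2 ^ m := by ring
  -- At k = N/8 the indices k and N/4-k coincide, and so do k+N/4 and N/2-k. Two of the four outputs
  -- suffice.
  obtain ⟨h0, -, -, h3⟩ := powDFT_butterfly (m + 1) y (2 ^ m : ℕ) rfl rfl rfl rfl rfl rfl
  rw [Int.cast_natCast] at h0 h3
  have ez : (2 : ℤ) * 2 ^ (m + 1) - (2 ^ m : ℕ) = (3 * 2 ^ m : ℕ) := by push_cast; ring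
  rw [ez] at h3
  rw [ofReal_div, ofReal_div, r1, r1, hz.1, hz.2, hz'.1, hz'.2, ← add_div, ← add_div, e8, e4, e3,
    map_div₀, conj_ofReal] at h
  have r2 : ∀ y, conj (powDFT (m + 1) y (2 ^ m : ℕ)) = powDFT (m + 1) y (2 ^ m : ℕ) :=
    fun y => by rw [← r1, conj_ofReal]
  rw [h0, h3, map_add, map_mul, map_mul, conj_conj, r2, r2]
  have sy : scaleFactor (m + 3) (3 * 2 ^ m) = scaleFactor (m + 3) (2 ^ m) :=
    scaleFactor_symm ⟨2, by ring⟩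
  have sy' : scaleFactor (m + 4) (2 ^ m) = scaleFactor (m + 4) (3 * 2 ^ m) :=
    scaleFactor_symm ⟨1, by ring⟩
  constructor
  · convert h.1 using 1
    have := mu_mul_add_rho_mul ℓ (m := m + 2) (k := 2 ^ m) (u := 2 ^ m) (i := 2 ^ m) (j := 2 ^ m)
      rfl rfl rfl rfl
    simpa only [one_mul] using (this _ _ 1).symm
  · convert h.2 using 1
    have := mu_mul_add_rho_mul ℓ (m := m + 2) (k := 2 ^ m) (u := 2 ^ m) (i := 2 ^ m)
      (j := 3 * 2 ^ m) rfl sy sy' sy'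
    simpa only [neg_mul, one_mul, ← sub_eq_add_neg] using (this _ _ (-1)).symm

/-! ## The transform for real inputs -/

/-- The number of instructions of `realFFT`. -/
def Scaling.costFFT : Scaling → ℕ → ℕ
  | _, 0 => 0
  | .four, 1 => 3
  | _, 1 => 2
  | ℓ, 2 => ℓ.sub.costFFT 1 + ℓ.costZero
  | ℓ, m + 3 => ℓ.sub.costFFT (m + 2) + 2 * Scaling.one.costFFT (m + 1) + ℓ.costZero +
      ℓ.costEighth + (2 ^ m - 1) * ℓ.costGeneral

/-- The table `W` holds the DFT of size `2 ^ m`, where the output with index `k` is divided by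
`s_{ℓN,k}`. -/
def HoldsDFT {M : ℕ} (x : Fin M → ℝ) (p : List (Instr M)) (ℓ : Scaling) (m : ℕ) (y : ℕ → ℝ)
    (W : ℕ → CReg M) : Prop :=
  Holds x p (W 0).re (powDFT m y 0).re ∧
  Holds x p (W (2 ^ m / 2)).re
    ((powDFT m y (2 ^ m / 2 : ℕ)).re / scaleFactor (m + ℓ.shift) (2 ^ m / 2)) ∧
  ∀ k, 0 < k → k < 2 ^ m / 2 →
    CHolds x p (W k) (powDFT m y k / scaleFactor (m + ℓ.shift) k)

theorem HoldsDFT.mono {M : ℕ} {x : Fin M → ℝ} {p p' : List (Instr M)} {ℓ : Scaling} {m : ℕ}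
    {y : ℕ → ℝ} {W : ℕ → CReg M} (h : HoldsDFT x p ℓ m y W) (hp : p <+: p') :
    HoldsDFT x p' ℓ m y W :=
  ⟨h.1.mono hp, h.2.1.mono hp, fun k h₁ h₂ => (h.2.2 k h₁ h₂).mono hp⟩

theorem powDFT_zero_left (y : ℕ → ℝ) (k : ℤ) : powDFT 0 y k = y 0 := by
  simp [powDFT]

theorem powDFT_one_zero (y : ℕ → ℝ) : powDFT 1 y 0 = y 0 + y 1 := by
  simp [powDFT, Finset.sum_range_succ]

theorem powDFT_one_one (y : ℕ → ℝ) : powDFT 1 y 1 = y 0 - y 1 := by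
  have : exp (-(2 * Real.pi * I / 2)) = -1 := by
    rw [show 2 * Real.pi * I / 2 = Real.pi * I by ring, exp_neg, exp_pi_mul_I]
    norm_num
  simp [powDFT, Finset.sum_range_succ, this, sub_eq_add_neg]

theorem spec_realFFT_one {M : ℕ} {x : Fin M → ℝ} {p : List (Instr M)} (ℓ : Scaling)
    {X : ℕ → Reg M} {y : ℕ → ℝ} (hX : ∀ n, Holds x p (X n) (y n)) :
    Spec p (realFFT ℓ 1 X) (ℓ.costFFT 1) fun W p' => HoldsDFT x p' ℓ 1 y W := by
  have e0 : (powDFT 1 y 0).re = y 0 + y 1 := by rw [powDFT_one_zero]; simp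
  have e1 : (powDFT 1 y (2 ^ 1 / 2 : ℕ)).re = y 0 - y 1 := by
    norm_num [powDFT_one_one]
  have key : ∀ (a b : Reg M) p', Holds x p' a (y 0 + y 1) →
      Holds x p' b ((y 0 - y 1) / scaleFactor (1 + ℓ.shift) 1) →
      HoldsDFT x p' ℓ 1 y fun k => if k = 0 then ⟨a, a⟩ else ⟨b, b⟩ := by
    refine fun a b p' ha hb => ⟨by simpa [e0] using ha, ?_, fun k h₁ h₂ => by simp at h₂; omega⟩
    rw [e1]
    simpa using hb
  cases ℓ
  · refine Spec.mono (n := 1 + (1 + 0)) ?_ rfl fun _ _ _ h => h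
    rw [realFFT]
    refine Spec.bind (spec_add (hX 0) (hX 1) rfl) fun a p₁ h₁ ha => ?_
    refine Spec.bind (spec_sub ((hX 0).mono h₁) ((hX 1).mono h₁) rfl) fun b p₂ h₂ hb => ?_
    exact Spec.pure (key _ _ _ (ha.mono h₂) (by
      simpa [Scaling.shift, scaleFactor_of_lt] using hb))
  · refine Spec.mono (n := 1 + (1 + 0)) ?_ rfl fun _ _ _ h => h
    rw [realFFT]
    refine Spec.bind (spec_add (hX 0) (hX 1) rfl) fun a p₁ h₁ ha => ?_
    refine Spec.bind (spec_sub ((hX 0).mono h₁) ((hX 1).mono h₁) rfl) fun b p₂ h₂ hb => ?_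
    exact Spec.pure (key _ _ _ (ha.mono h₂) (by
      simpa [Scaling.shift, scaleFactor_of_lt] using hb))
  · refine Spec.mono (n := 1 + (1 + (1 + 0))) ?_ rfl fun _ _ _ h => h
    rw [realFFT]
    refine Spec.bind (spec_add (hX 0) (hX 1) rfl) fun a p₁ h₁ ha => ?_
    refine Spec.bind (spec_sub ((hX 0).mono h₁) ((hX 1).mono h₁) rfl) fun b p₂ h₂ hb => ?_
    refine Spec.bind (spec_mul hb rfl) fun c p₃ h₃ hc => ?_
    refine Spec.pure (key _ _ _ (ha.mono (h₂.trans h₃)) ?_)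
    convert hc using 1
    simp [Scaling.shift, div_eq_inv_mul]

theorem spec_realFFT {M : ℕ} {x : Fin M → ℝ} (m : ℕ) (ℓ : Scaling) (p : List (Instr M))
    {X : ℕ → Reg M} {y : ℕ → ℝ} (hX : ∀ n, Holds x p (X n) (y n)) :
    Spec p (realFFT ℓ m X) (ℓ.costFFT m) fun W p' => HoldsDFT x p' ℓ m y W := by
  induction m using Nat.strong_induction_on generalizing ℓ p X y with
  | _ m ih =>
  match m with
  | 0 =>
    rw [realFFT]
    refine Spec.mono (n := 0) (Spec.pure ⟨?_, ?_, fun k h₁ h₂ => ?_⟩)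
      (by simp [Scaling.costFFT]) fun _ _ _ h => h
    · simpa [powDFT_zero_left] using hX 0
    · simpa [powDFT_zero_left, scaleFactor_zero_right] using hX 0
    · simp at h₂
  | 1 => exact spec_realFFT_one ℓ hX
  | 2 =>
    -- The nested sum follows the binds of the procedure; the zeros are the two transforms of size 1
    -- and the final `pure`.
    refine Spec.mono (n := ℓ.sub.costFFT 1 + (0 + (0 + (ℓ.costZero + 0)))) ?_
      (by cases ℓ <;> rfl) fun _ _ _ h => h
    rw [realFFT]
    refine Spec.bind (ih 1 (by omega) ℓ.sub p (y := fun n => y (2 * n)) fun n => hX (2 * n))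
      fun U p₁ h₁ hU => ?_
    refine Spec.bind (ih 0 (by omega) .one p₁ (y := fun n => y (4 * n + 1)) fun n =>
      (hX (4 * n + 1)).mono h₁) fun Z p₂ h₂ hZ => ?_
    refine Spec.bind (ih 0 (by omega) .one p₂ (y := fun n => y ((4 * n + 3) % 4)) fun n =>
      (hX ((4 * n + 3) % 4)).mono (h₁.trans h₂)) fun Z' p₃ h₃ hZ' => ?_
    have hU := hU.mono (h₂.trans h₃)
    refine Spec.bind (spec_stepZero_powDFT ℓ 0 y hU.1 hU.2.1 (hZ.1.mono h₃) hZ'.1)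
      fun r p₄ h₄ hr => ?_
    obtain ⟨x0, x1, x2⟩ := r
    refine Spec.pure ⟨hr.1, hr.2.2, fun k h₁ h₂ => ?_⟩
    obtain rfl : k = 1 := by simp at h₂; omega
    exact hr.2.1
  | m + 3 =>
    have hp := Nat.two_pow_pos m
    have eN : 2 ^ (m + 3) / 2 = 4 * 2 ^ m := by rw [pow_add]; omega
    have eU : 2 ^ (m + 2) / 2 = 2 * 2 ^ m := by rw [pow_add]; omega
    have eZ : 2 ^ (m + 1) / 2 = 2 ^ m := by rw [pow_add]; omega
    refine Spec.mono (n := ℓ.sub.costFFT (m + 2) + (Scaling.one.costFFT (m + 1) +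
      (Scaling.one.costFFT (m + 1) + (ℓ.costZero + (ℓ.costEighth +
        ((2 ^ m - 1) * ℓ.costGeneral + 0)))))) ?_
      (by rw [Scaling.costFFT]; ring) fun _ _ _ h => h
    rw [realFFT]
    refine Spec.bind (ih (m + 2) (by omega) ℓ.sub p (y := fun n => y (2 * n)) fun n => hX (2 * n))
      fun U p₁ h₁ hU => ?_
    refine Spec.bind (ih (m + 1) (by omega) .one p₁ (y := fun n => y (4 * n + 1)) fun n =>
      (hX (4 * n + 1)).mono h₁) fun Z p₂ h₂ hZ => ?_
    refine Spec.bind (ih (m + 1) (by omega) .one p₂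
      (y := fun n => y ((4 * n + (2 ^ (m + 3) - 1)) % 2 ^ (m + 3))) fun n =>
      (hX ((4 * n + (2 ^ (m + 3) - 1)) % 2 ^ (m + 3))).mono (h₁.trans h₂)) fun Z' p₃ h₃ hZ' => ?_
    replace hU := hU.mono (h₂.trans h₃)
    replace hZ := hZ.mono h₃
    clear h₁ h₂ h₃ hX ih
    unfold HoldsDFT at hU hZ hZ' ⊢
    rw [eU] at hU
    rw [eZ] at hZ hZ'
    rw [eN]
    have e1 : 2 * 2 ^ m = 2 ^ (m + 1) := by ring
    refine Spec.bind (spec_stepZero_powDFT ℓ (m + 1) y hU.1 (e1 ▸ hU.2.1) hZ.1 hZ'.1)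
      fun r p₄ h₄ hr => ?_
    obtain ⟨x0, x1, x2⟩ := r
    refine Spec.bind (spec_stepEighth_powDFT ℓ m y
      ((hU.2.2 (2 ^ m) hp (by omega)).mono h₄) (hZ.2.1.mono h₄) (hZ'.2.1.mono h₄))
      fun r p₅ h₅ hr' => ?_
    obtain ⟨y1, y3⟩ := r
    refine Spec.bind (spec_forOneTo (y1, y1, y1, y1) (fun _ _ _ _ h H =>
      ⟨H.1.mono h, H.2.1.mono h, H.2.2.1.mono h, H.2.2.2.mono h⟩) fun k hk₁ hk₂ p' hp' =>
      spec_stepGeneral_powDFT ℓ (k := k) (by omega) y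
        ((hU.2.2 k hk₁ (by omega)).mono ((h₄.trans h₅).trans hp'))
        ((hU.2.2 (2 * 2 ^ m - k) (by omega) (by omega)).mono ((h₄.trans h₅).trans hp'))
        ((hZ.2.2 k hk₁ (by omega)).mono ((h₄.trans h₅).trans hp'))
        ((hZ'.2.2 k hk₁ (by omega)).mono ((h₄.trans h₅).trans hp'))) fun W p₆ h₆ hW => ?_
    have h46 := h₅.trans h₆
    have e2 : 2 * 2 ^ (m + 1) = 4 * 2 ^ m := by ring
    rw [e2, ← e1] at hr
    refine Spec.pure ⟨?_, ?_, fun k hk₁ hk₂ => ?_⟩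
    · beta_reduce
      rw [if_pos rfl]
      exact hr.1.mono h46
    · beta_reduce
      repeat rw [if_neg (by omega)]
      exact hr.2.2.mono h46
    · beta_reduce
      split_ifs with c0 c1 c2 c3 c4 c5 c6
      · omega
      · exact (hW k hk₁ (by omega)).1
      · rw [c2]
        exact hr'.1.mono h₆
      · have := (hW (2 * 2 ^ m - k) (by omega) (by omega)).2.2.1
        rwa [show 2 * 2 ^ m - (2 * 2 ^ m - k) = k by omega] at this
      · rw [c4]
        exact hr.2.1.mono h46
      · have := (hW (k - 2 * 2 ^ m) (by omega) (by omega)).2.1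
        rwa [show k - 2 * 2 ^ m + 2 * 2 ^ m = k by omega] at this
      · rw [c6]
        exact hr'.2.mono h₆
      · have := (hW (4 * 2 ^ m - k) (by omega) (by omega)).2.2.2
        rwa [show 4 * 2 ^ m - (4 * 2 ^ m - k) = k by omega] at this

/-! ## The DCT-II algorithm -/

/-- The unnormalized DCT-II `∑ x_n cos[π (n + 1/2) k / N]`. -/
noncomputable def dctSum {N : ℕ} (x : Fin N → ℝ) (k : ℕ) : ℝ :=
  ∑ n : Fin N, x n * Real.cos (Real.pi / N * ((n : ℝ) + 1 / 2) * (k : ℝ))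

/-- The even-indexed entries, followed by the odd-indexed entries in reverse order. -/
def dctReorder {N : ℕ} [NeZero N] {A : Type*} (x : Fin N → A) (n : ℕ) : A :=
  if n < N / 2 then x (Fin.ofNat N (2 * n)) else x (Fin.ofNat N (2 * (N - 1 - n) + 1))

theorem sum_range_two_mul {A : Type*} [AddCommMonoid A] (f : ℕ → A) (h : ℕ) :
    ∑ n ∈ Finset.range (2 * h), f n =
      ∑ n ∈ Finset.range h, f (2 * n) + ∑ n ∈ Finset.range h, f (2 * n + 1) := by
  induction h with
  | zero => simp
  | succ h ih =>
    simp only [mul_add, mul_one, Finset.sum_range_succ, ih]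
    abel

theorem sum_range_evens_odds {A : Type*} [AddCommMonoid A] {f g : ℕ → A} {N h : ℕ}
    (hN : N = 2 * h) (h₁ : ∀ n < h, f n = g (2 * n))
    (h₂ : ∀ n < h, f (2 * h - 1 - n) = g (2 * n + 1)) :
    ∑ n ∈ Finset.range N, f n = ∑ n ∈ Finset.range N, g n := by
  subst hN
  rw [sum_range_two_mul g, two_mul, Finset.sum_range_add]
  congr 1
  · exact Finset.sum_congr rfl fun n hn => h₁ n (Finset.mem_range.1 hn)
  · rw [← Finset.sum_range_reflect]
    refine Finset.sum_congr rfl fun n hn => ?_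
    rw [← h₂ n (Finset.mem_range.1 hn)]
    congr 1
    have := Finset.mem_range.1 hn
    omega

theorem exp_mul_powDFT (m : ℕ) (y : ℕ → ℝ) (k : ℕ) :
    exp (-(2 * Real.pi * k / (4 * 2 ^ m) : ℝ) * I) * powDFT m y k =
      ∑ n ∈ Finset.range (2 ^ m),
        y n * exp (-(Real.pi / 2 ^ m * (2 * n + 1 / 2) * k : ℝ) * I) := by
  rw [powDFT, Finset.mul_sum]
  refine Finset.sum_congr rfl fun n _ => ?_
  rw [mul_left_comm, ← exp_add]
  congr 2
  push_cast
  field_simp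
  ring

/-- The entry N-1-n of the reordered input is x_{2n+1}. Its angle is 2πk minus the angle of index
2n+1 in the DCT-II, so the cosines agree. -/
theorem re_exp_mul_powDFT {m : ℕ} (hm : 1 ≤ m) (x : Fin (2 ^ m) → ℝ) (k : ℕ) :
    (exp (-(2 * Real.pi * k / (4 * 2 ^ m) : ℝ) * I) * powDFT m (dctReorder x) k).re =
      dctSum x k := by
  obtain ⟨m, rfl⟩ := Nat.exists_eq_add_of_le' hm
  have hN : 2 ^ (m + 1) = 2 * 2 ^ m := by ring
  have hp := Nat.two_pow_pos m
  have e : dctSum x k = ∑ n ∈ Finset.range (2 ^ (m + 1)), x (Fin.ofNat _ n) *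
      Real.cos (Real.pi / 2 ^ (m + 1) * ((n : ℝ) + 1 / 2) * k) := by
    rw [Finset.sum_range, dctSum]
    exact Finset.sum_congr rfl fun n _ => by simp
  rw [e, exp_mul_powDFT, re_sum]
  refine sum_range_evens_odds hN (fun n hn => ?_) fun n hn => ?_
  · rw [re_ofReal_mul, ← ofReal_neg, exp_ofReal_mul_I_re, Real.cos_neg, dctReorder,
      if_pos (by omega)]
    push_cast
    rfl
  · have hle : n + 1 ≤ 2 * 2 ^ m := by omega
    rw [re_ofReal_mul, ← ofReal_neg, exp_ofReal_mul_I_re, Real.cos_neg, dctReorder,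
      if_neg (by omega), show 2 ^ (m + 1) - 1 - (2 * 2 ^ m - 1 - n) = n by omega,
      ← Real.cos_nat_mul_two_pi_sub _ k]
    congr 2
    rw [Nat.sub_sub, add_comm 1 n, Nat.cast_sub hle]
    push_cast
    rw [pow_succ]
    field_simp
    ring

/-- With θ the angle at index n and frequency k, replacing k by N-k turns cos θ into (-1)^n sin θ.
The reversal of the odd-indexed entries supplies exactly this sign, since sin(2πk - θ) = -sin θ. -/
theorem neg_im_exp_mul_powDFT {m : ℕ} (hm : 1 ≤ m) (x : Fin (2 ^ m) → ℝ) {k : ℕ}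
    (hk : k ≤ 2 ^ m) :
    -(exp (-(2 * Real.pi * k / (4 * 2 ^ m) : ℝ) * I) * powDFT m (dctReorder x) k).im =
      dctSum x (2 ^ m - k) := by
  obtain ⟨m, rfl⟩ := Nat.exists_eq_add_of_le' hm
  have hN : 2 ^ (m + 1) = 2 * 2 ^ m := by ring
  have hp := Nat.two_pow_pos m
  have e : dctSum x (2 ^ (m + 1) - k) = ∑ n ∈ Finset.range (2 ^ (m + 1)), x (Fin.ofNat _ n) *
      Real.cos (Real.pi / 2 ^ (m + 1) * ((n : ℝ) + 1 / 2) * (2 ^ (m + 1) - k)) := by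
    rw [Finset.sum_range, dctSum]
    exact Finset.sum_congr rfl fun n _ => by simp [hk]
  rw [e, exp_mul_powDFT, im_sum, ← Finset.sum_neg_distrib]
  refine sum_range_evens_odds hN (fun n hn => ?_) fun n hn => ?_
  · rw [im_ofReal_mul, ← ofReal_neg, exp_ofReal_mul_I_im, Real.sin_neg, mul_neg, neg_neg,
      dctReorder, if_pos (by omega), ← Real.cos_pi_div_two_sub]
    congr 1
    rw [Real.cos_eq_cos_iff]
    -- At index 2n the angle for frequency N-k is 2πn + π/2 - θ.
    refine ⟨n, Or.inl ?_⟩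
    push_cast
    field_simp
    ring
  · have hle : n + 1 ≤ 2 * 2 ^ m := by omega
    rw [im_ofReal_mul, ← ofReal_neg, exp_ofReal_mul_I_im, Real.sin_neg, mul_neg, neg_neg,
      dctReorder, if_neg (by omega), show 2 ^ (m + 1) - 1 - (2 * 2 ^ m - 1 - n) = n by omega,
      ← Real.cos_pi_div_two_sub]
    congr 1
    rw [Real.cos_eq_cos_iff]
    -- The reordered angle is 2πk - θ and the target angle is 2πn + 3π/2 - θ, so π/2 minus the
    -- former and the latter sum to 2π(n+1-k).
    refine ⟨n + 1 - k, Or.inr ?_⟩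
    rw [Nat.sub_sub, add_comm 1 n, Nat.cast_sub hle]
    push_cast
    rw [pow_succ]
    field_simp
    ring

theorem spec_newDCTBody {m : ℕ} (hm : 1 ≤ m) (c₀ c : ℝ) (x : Fin (2 ^ m) → ℝ) :
    Spec [] (newDCTBody m c₀ c) (Scaling.one.costFFT m + 2 + (2 ^ m / 2 - 1) * 6) fun r p =>
      ∀ k < 2 ^ m, Holds x p (r k) ((if k = 0 then c₀ else c) * dctSum x k) := by
  have hp := Nat.two_pow_pos m
  have hN : 2 ^ m / 2 + 2 ^ m / 2 = 2 ^ m := by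
    obtain ⟨m, rfl⟩ := Nat.exists_eq_add_of_le' hm
    omega
  refine Spec.mono (n := Scaling.one.costFFT m + (1 + ((2 ^ m / 2 - 1) * 6 + (1 + 0)))) ?_
    (by ring) fun _ _ _ h => h
  unfold newDCTBody
  refine Spec.bind (spec_realFFT m .one [] (x := x) (y := dctReorder x) fun n => ?_)
    fun Z p₁ h₁ hZ => ?_
  · unfold dctReorder
    split_ifs
    · exact ⟨trivial, rfl⟩
    · exact ⟨trivial, rfl⟩
  refine Spec.bind (spec_mul hZ.1 rfl) fun a p₂ h₂ ha => ?_
  refine Spec.bind (spec_forOneTo (c := 6) (a, a)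
    (Q := fun k r p => Holds x p r.1 (c * dctSum x k) ∧ Holds x p r.2 (c * dctSum x (2 ^ m - k)))
    (fun _ _ _ _ h H => ⟨H.1.mono h, H.2.mono h⟩) fun k hk₁ hk₂ p hp => ?_) fun W p₃ h₃ hW => ?_
  · have hZk := (hZ.2.2 k hk₁ (by omega)).mono (h₂.trans hp)
    refine Straight.spec x fun w hin => ?_
    obtain ⟨hr, hr'⟩ := holds_data hin hZk.1
    obtain ⟨hi, hi'⟩ := holds_data hin hZk.2
    have hs : scaleFactor (m + Scaling.one.shift) k = scaleFactor m k := rfl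
    have hs0 := (scaleFactor_pos m k).ne'
    rw [hs, div_ofReal_re] at hr'
    rw [hs, div_ofReal_im] at hi'
    have hre := re_exp_mul_powDFT hm x k
    have him := neg_im_exp_mul_powDFT hm x (k := k) (by omega)
    rw [← ofReal_neg, mul_re, exp_ofReal_mul_I_re, exp_ofReal_mul_I_im, Real.cos_neg,
      Real.sin_neg] at hre
    rw [← ofReal_neg, mul_im, exp_ofReal_mul_I_re, exp_ofReal_mul_I_im, Real.cos_neg,
      Real.sin_neg] at him
    generalize p.length = L at *
    repeat' first
      | with_reducible refine Straight.add ?_ ?_ fun _ _ => ?_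
      | with_reducible refine Straight.sub ?_ ?_ fun _ _ => ?_
      | with_reducible refine Straight.mul ?_ fun _ _ => ?_
      | with_reducible refine Straight.pure ?_
      | with_reducible exact Reg.Available.mono ‹_› (by omega)
    -- The equations arrive in reverse order of execution: `v6` belongs to the last instruction.
    intro v6 v5 v4 v3 v2 v1 p' hout
    refine ⟨hout _ _ ?_ ?_, hout _ _ ?_ ?_⟩
    · with_reducible exact Reg.Available.mono ‹_› (by omega)
    · rw [v5, v1, v2, hr', hi', ← hre]
      field_simp
      ring
    · with_reducible exact Reg.Available.mono ‹_› (by omega)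
    · rw [v6, v3, v4, hr', hi', ← him]
      field_simp
      ring
  have h12 : 2 ^ m ∣ 4 * (2 ^ m / 2) := ⟨2, by omega⟩
  refine Spec.bind (spec_mul (hZ.2.1.mono (h₂.trans h₃)) (w := c * dctSum x (2 ^ m / 2)) ?_)
    fun b p₄ h₄ hb => ?_
  · have hre := re_exp_mul_powDFT hm x (2 ^ m / 2)
    -- At k = N/2 the transform is real and unscaled, and the rotation by π/4 contributes only its
    -- cosine 1/√2.
    have hang : 2 * Real.pi * ((2 ^ m / 2 : ℕ) : ℝ) / (4 * 2 ^ m) = Real.pi / 4 := by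
      have : (2 : ℝ) ^ m = ((2 ^ m / 2 : ℕ) : ℝ) + ((2 ^ m / 2 : ℕ) : ℝ) := by
        exact_mod_cast hN.symm
      have h2 : (2 : ℝ) ^ m ≠ 0 := by positivity
      field_simp
      linarith
    rw [← ofReal_neg, mul_re, exp_ofReal_mul_I_re, exp_ofReal_mul_I_im, Real.cos_neg,
      powDFT_im_eq_zero m _ ⟨1, by norm_cast; omega⟩, hang, Real.cos_pi_div_four, mul_zero,
      sub_zero] at hre
    have hs : scaleFactor (m + Scaling.one.shift) (2 ^ m / 2) = 1 := scaleFactor_eq_one h12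
    rw [hs, div_one, ← hre]
    have := Real.sqrt_ne_zero'.2 (zero_lt_two' ℝ)
    field_simp
    rw [Real.sq_sqrt zero_le_two]
    ring
  refine Spec.pure fun k hk => ?_
  split_ifs with c0 c1 c2
  · have hre := re_exp_mul_powDFT hm x 0
    rw [c0, ← hre]
    simpa using ha.mono (h₃.trans h₄)
  · exact (hW k (by omega) (by omega)).1.mono h₄
  · rw [c2]
    exact hb
  · have := (hW (2 ^ m - k) (by omega) (by omega)).2.mono h₄
    rwa [show 2 ^ m - (2 ^ m - k) = k by omega] at this

theorem newDCTProgram_correct {m : ℕ} (hm : 1 ≤ m) (c₀ c : ℝ) :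
    (newDCTProgram m c₀ c).Valid ∧
    (newDCTProgram m c₀ c).flops = Scaling.one.costFFT m + 2 + (2 ^ m / 2 - 1) * 6 ∧
    ∀ x k, (newDCTProgram m c₀ c).run x k = (if (k : ℕ) = 0 then c₀ else c) * dctSum x k := by
  have key := spec_newDCTBody hm c₀ c
  have hcode : (newDCTProgram m c₀ c).code = ((newDCTBody m c₀ c).run []).2 := rfl
  have hout : ∀ k, (newDCTProgram m c₀ c).out k = ((newDCTBody m c₀ c).run []).1 k := fun _ => rfl
  refine ⟨⟨fun i hi => ?_, fun k => ?_⟩, ?_, fun x k => ?_⟩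
  -- The code is independent of the input, so any input, here 0, exhibits its length and the
  -- availability of its operands.
  · obtain ⟨a, q, hr, hl, ha, -⟩ := key 0
    have hc : (newDCTProgram m c₀ c).code = q := by rw [hcode, hr]; rfl
    subst hc
    simpa using ha.getElem i hi
  · obtain ⟨a, q, hr, hl, ha, h⟩ := key 0
    rw [hout, hcode, hr]
    exact (h k k.2).1
  · obtain ⟨a, q, hr, hl, -⟩ := key 0
    rw [Program.flops, hcode, hr]
    exact hl
  · obtain ⟨a, q, hr, hl, ha, h⟩ := key x
    rw [Program.run, hout, hcode, hr]
    exact (h k k.2).2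

/-! ## Operation counts -/

/-- Scalings 1 and 4 recurse in the same way, so their costs differ only by step costs. Eliminating
the other two leaves, for scaling 1, a_m = 3a_{m-2} + 2a_{m-3} plus forcing, with characteristic
polynomial (λ-2)(λ+1)². The double root -1 gives the terms (-1)^m and (-1)^m m, and the resonance of
the forcing 2^m with the root 2 gives 2^m m. -/
theorem costFFT_eq (m : ℕ) (hm : 1 ≤ m) :
    (Scaling.one.costFFT m : ℝ) =
      17 / 9 * 2 ^ m * m - 98 / 27 * 2 ^ m - 1 / 9 * (-1) ^ m * m + 7 / 54 * (-1) ^ m + 11 / 2 ∧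
    (Scaling.two.costFFT m : ℝ) =
      17 / 9 * 2 ^ m * m - 80 / 27 * 2 ^ m - 1 / 9 * (-1) ^ m * m + 25 / 54 * (-1) ^ m + 9 / 2 ∧
    (Scaling.four.costFFT m : ℝ) =
      17 / 9 * 2 ^ m * m - 71 / 27 * 2 ^ m - 1 / 9 * (-1) ^ m * m + 7 / 54 * (-1) ^ m + 9 / 2 := by
  induction m using Nat.strong_induction_on with
  | _ m ih =>
  match m with
  | 1 => norm_num [Scaling.costFFT]
  | 2 => norm_num [Scaling.costFFT, Scaling.sub, Scaling.costZero]
  | m + 3 =>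
    obtain ⟨h1, -, -⟩ := ih (m + 1) (by omega) (by omega)
    obtain ⟨-, h2, h4⟩ := ih (m + 2) (by omega) (by omega)
    simp only [Scaling.costFFT, Scaling.sub, Scaling.costZero, Scaling.costEighth,
      Scaling.costGeneral]
    push_cast [Nat.one_le_two_pow] at h1 h2 h4 ⊢
    rw [h1, h2, h4]
    refine ⟨?_, ?_, ?_⟩ <;> ring

theorem newDCTProgram_flops {m : ℕ} (hm : 1 ≤ m) (c₀ c : ℝ) :
    ((newDCTProgram m c₀ c).flops : ℝ) = newFlopCount (2 ^ m) := by
  rw [(newDCTProgram_correct hm c₀ c).2.1, newFlopCount, Nat.log_pow (by norm_num)]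
  obtain ⟨m, rfl⟩ := Nat.exists_eq_add_of_le' hm
  rw [show 2 ^ (m + 1) / 2 = 2 ^ m by rw [pow_succ]; omega]
  push_cast [Nat.one_le_two_pow]
  rw [(costFFT_eq (m + 1) hm).1]
  push_cast
  ring

theorem newFlopCount_two_pow (m : ℕ) :
    newFlopCount (2 ^ m) = 17 / 9 * 2 ^ m * m - 17 / 27 * 2 ^ m - 1 / 9 * (-1) ^ m * m +
      7 / 54 * (-1) ^ m + 3 / 2 := by
  rw [newFlopCount, Nat.log_pow (by norm_num)]
  push_cast
  ring

/-- The remaining terms are bounded by multiples of 2^m, using 1 ≤ 2^m and m ≤ 2^m; the constant 4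
is not sharp. -/
theorem abs_newFlopCount_sub_le (m : ℕ) :
    |newFlopCount (2 ^ m) - 17 / 9 * (2 ^ m : ℝ) * m| ≤ 4 * 2 ^ m := by
  rw [newFlopCount_two_pow]
  have h1 : (1 : ℝ) ≤ 2 ^ m := one_le_pow₀ one_le_two
  have h2 : (m : ℝ) ≤ 2 ^ m := by exact_mod_cast Nat.lt_two_pow_self.le
  have h0 : (0 : ℝ) ≤ m := by positivity
  rw [abs_le]
  rcases neg_one_pow_eq_or ℝ m with h | h <;> rw [h] <;> constructor <;> linarith

theorem newFlopCount_le_previousFlopCount {m : ℕ} (hm : 1 ≤ m) :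
    newFlopCount (2 ^ m) ≤ previousFlopCount (2 ^ m) ∧
      (newFlopCount (2 ^ m) < previousFlopCount (2 ^ m) ↔ 4 ≤ m) := by
  have hprev : previousFlopCount (2 ^ m) = 2 * 2 ^ m * m - 2 ^ m + 2 := by
    rw [previousFlopCount, Nat.log_pow (by norm_num)]
    push_cast
    ring
  rw [hprev, newFlopCount_two_pow]
  rcases lt_or_ge m 4 with h | h
  -- For N = 2, 4, 8 the two counts coincide.
  · interval_cases m <;> norm_num
  · have hlt : 17 / 9 * 2 ^ m * m - 17 / 27 * 2 ^ m - 1 / 9 * (-1) ^ m * m +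
      7 / 54 * (-1) ^ m + 3 / 2 < (2 * 2 ^ m * m - 2 ^ m + 2 : ℝ) := by
      have h4 : (4 : ℝ) ≤ m := by exact_mod_cast h
      have h16 : (16 : ℝ) ≤ 2 ^ m := by
        calc (16 : ℝ) = 2 ^ 4 := by norm_num
          _ ≤ 2 ^ m := pow_le_pow_right₀ one_le_two h
      -- The leading part of the difference is 2^m (m/9 - 10/27), which is positive from m = 4 on.
      rcases neg_one_pow_eq_or ℝ m with e | e <;> rw [e] <;> nlinarith
    exact ⟨hlt.le, iff_of_true hlt h⟩

/-! ## The DCT-II as a real-even DFT -/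

theorem evenExtension_neg {N : ℕ} [NeZero N] (x : Fin N → ℝ) (j : ZMod (4 * N)) :
    evenExtension x (-j) = evenExtension x j := by
  have hN := NeZero.pos N
  rcases eq_or_ne j 0 with rfl | hj
  · rw [neg_zero]
  have : NeZero j := ⟨hj⟩
  have hlt : j.val < 4 * N := ZMod.val_lt j
  have h0 : 0 < j.val := Nat.pos_of_ne_zero ((ZMod.val_ne_zero j).2 hj)
  unfold evenExtension
  rw [ZMod.val_neg_of_ne_zero]
  generalize j.val = i at *
  by_cases h2 : i % 2 = 0
  · rw [if_pos h2, if_pos (by omega)]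
  rw [if_neg h2, if_neg (by omega)]
  split_ifs
  · omega
  · congr 2
    omega
  · congr 2
    omega
  · omega

theorem sum_zmod_eq_sum_range {A : Type*} [AddCommMonoid A] {n : ℕ} [NeZero n] (f : ZMod n → A) :
    ∑ j, f j = ∑ i ∈ Finset.range n, f i := by
  refine Finset.sum_nbij' (fun j => j.val) (fun i => (i : ZMod n)) ?_ ?_ ?_ ?_ ?_
  · simp [ZMod.val_lt]
  · simp
  · simp
  · intro i hi
    exact ZMod.val_cast_of_lt (Finset.mem_range.1 hi)
  · simp

/-- Only odd indices contribute. The entries 2n+1 and 4N-(2n+1) both equal x_n and carry conjugate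
exponentials, which add up to twice a cosine. -/
theorem dctII_eq_dft {N : ℕ} [NeZero N] (x : Fin N → ℝ) (k : Fin N) :
    (dctII x k : ℂ) = ZMod.dft (fun j : ZMod (4 * N) => (evenExtension x j : ℂ))
      (((k : ℕ) : ZMod (4 * N))) := by
  have hN := NeZero.pos N
  have hN0 : (N : ℂ) ≠ 0 := by exact_mod_cast hN.ne'
  have hval : ∀ i < 4 * N, (i : ZMod (4 * N)).val = i := fun i hi => ZMod.val_cast_of_lt hi
  have he : ∀ n < 2 * N, evenExtension x ((2 * n : ℕ) : ZMod (4 * N)) = 0 := fun n hn => by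
    rw [evenExtension, hval _ (by omega), if_pos (by omega)]
  have ho : ∀ n < N, evenExtension x ((2 * n + 1 : ℕ) : ZMod (4 * N)) = x (Fin.ofNat N n) :=
    fun n hn => by
      rw [evenExtension, hval _ (by omega), if_neg (by omega), if_pos (by omega)]
      congr 2
      omega
  have ho' : ∀ n < N, evenExtension x ((2 * (N + (N - 1 - n)) + 1 : ℕ) : ZMod (4 * N)) =
      x (Fin.ofNat N n) := fun n hn => by
    rw [evenExtension, hval _ (by omega), if_neg (by omega), if_neg (by omega)]
    congr 2
    omega
  rw [ZMod.dft_apply, sum_zmod_eq_sum_range]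
  have hterm : ∀ i ∈ Finset.range (4 * N),
      ZMod.stdAddChar (-((i : ZMod (4 * N)) * ((k : ℕ) : ZMod (4 * N)))) •
      (evenExtension x (i : ZMod (4 * N)) : ℂ) = exp (-(2 * Real.pi * I * (i * k) / (4 * N))) *
        evenExtension x (i : ZMod (4 * N)) := fun i _ => by
    have := ZMod.stdAddChar_coe (N := 4 * N) (-(i * (k : ℕ)))
    push_cast at this ⊢
    rw [this, smul_eq_mul]
    congr 2
    ring
  -- The summand is made opaque so that the rewrites that split and reflect the sum act on plain
  -- applications of `g`.
  obtain ⟨g, hg⟩ : ∃ g, g = (fun i : ℕ => exp (-(2 * Real.pi * I * (i * (k : ℕ)) / (4 * N))) *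
    (evenExtension x (i : ZMod (4 * N)) : ℂ)) := ⟨_, rfl⟩
  have hg' : ∀ i : ℕ, exp (-(2 * Real.pi * I * (i * (k : ℕ)) / (4 * N))) *
    (evenExtension x (i : ZMod (4 * N)) : ℂ) = g i := fun i => by rw [hg]
  rw [Finset.sum_congr rfl fun i hi => (hterm i hi).trans (hg' i),
    show 4 * N = 2 * (2 * N) by ring, sum_range_two_mul, Finset.sum_eq_zero, zero_add, two_mul N,
    Finset.sum_range_add, ← Finset.sum_range_reflect (fun n => g (2 * (N + n) + 1)),
    ← Finset.sum_add_distrib, Finset.sum_range, dctII, ofReal_mul, ofReal_sum, Finset.mul_sum]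
  · refine Finset.sum_congr rfl fun n _ => ?_
    rw [← hg', ← hg', ho _ n.2, ho' _ n.2, ← add_mul, Fin.ofNat_val_eq_self,
      ofReal_mul (x n), ofReal_cos]
    have e1 : exp (-(2 * Real.pi * I * ((2 * (n : ℕ) + 1 : ℕ) * (k : ℕ)) / (4 * N))) =
        exp (-(Real.pi / N * ((n : ℝ) + 1 / 2) * (k : ℝ) : ℝ) * I) := by
      congr 1
      push_cast
      field_simp
      ring
    have e2 : exp (-(2 * Real.pi * I * ((2 * (N + (N - 1 - n)) + 1 : ℕ) * (k : ℕ)) / (4 * N))) =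
        exp ((Real.pi / N * ((n : ℝ) + 1 / 2) * (k : ℝ) : ℝ) * I) := by
      rw [exp_eq_exp_iff_exists_int]
      -- Since 2(2N-1-n)+1 = 4N-(2n+1), the two exponents differ by k full turns.
      refine ⟨-(k : ℕ), ?_⟩
      rw [Nat.sub_sub, Nat.cast_add, Nat.cast_mul, Nat.cast_add, Nat.cast_sub (by omega)]
      push_cast
      field_simp
      ring
    rw [e1, e2, ofReal_ofNat, mul_left_comm, two_cos]
    ring
  · intro n hn
    rw [← hg', he n (Finset.mem_range.1 hn)]
    simp

end

/-! ### Assembly of the main theorem -/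

theorem mainTheorem1 :
    -- the DCT-II as the first `N` outputs of a real-even DFT of size `4 N`, for `N = 2 ^ m > 1`
    (∀ m : ℕ, 1 ≤ m → ∀ x : Fin (2 ^ m) → ℝ,
      (∀ j : ZMod (4 * 2 ^ m), evenExtension x (-j) = evenExtension x j) ∧
      ∀ k : Fin (2 ^ m),
        (dctII x k : ℂ) =
          ZMod.dft (fun j : ZMod (4 * 2 ^ m) => (evenExtension x j : ℂ)) (((k : ℕ) : ZMod (4 * 2 ^ m)))) ∧
    -- the algorithm computes the DCT-II exactly, with the claimed number of operations
    (∀ m : ℕ, 1 ≤ m →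
      (newDCT m).Valid ∧ (∀ x : Fin (2 ^ m) → ℝ, (newDCT m).run x = dctII x) ∧
        ((newDCT m).flops : ℝ) = newFlopCount (2 ^ m)) ∧
    -- likewise for the unitary normalization
    (∀ m : ℕ, 1 ≤ m →
      (newDCTUnitary m).Valid ∧
        (∀ x : Fin (2 ^ m) → ℝ, (newDCTUnitary m).run x = dctIIUnitary x) ∧
        ((newDCTUnitary m).flops : ℝ) = newFlopCount (2 ^ m)) ∧
    -- the count is `17/9 N log₂ N + O(N)`
    (∃ K : ℝ, ∀ m : ℕ, 1 ≤ m →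
      |((newDCT m).flops : ℝ) - 17 / 9 * (2 ^ m : ℝ) * m| ≤ K * 2 ^ m) ∧
    -- comparison with the previous count: never worse, and better exactly from `N = 16` on
    (∀ m : ℕ, 1 ≤ m →
      ((newDCT m).flops : ℝ) ≤ previousFlopCount (2 ^ m) ∧
        (((newDCT m).flops : ℝ) < previousFlopCount (2 ^ m) ↔ 4 ≤ m)) := by
  refine ⟨fun m _ x => ⟨evenExtension_neg x, dctII_eq_dft x⟩, fun m hm => ?_, fun m hm => ?_,
    ⟨4, fun m hm => ?_⟩, fun m hm => ?_⟩
  · obtain ⟨hv, -, hr⟩ := newDCTProgram_correct hm 2 2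
    refine ⟨hv, fun x => funext fun k => ?_, newDCTProgram_flops hm 2 2⟩
    rw [newDCT, hr, ite_self, dctII, dctSum]
  · obtain ⟨hv, -, hr⟩ :=
      newDCTProgram_correct hm (Real.sqrt (1 / 2 ^ m)) (Real.sqrt (2 / 2 ^ m))
    refine ⟨hv, fun x => funext fun k => ?_, newDCTProgram_flops hm _ _⟩
    rw [newDCTUnitary, hr, dctIIUnitary, dctSum]
    split_ifs <;> norm_num
  · rw [newDCT, newDCTProgram_flops hm]
    exact abs_newFlopCount_sub_le m
  · rw [newDCT, newDCTProgram_flops hm]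
    exact newFlopCount_le_previousFlopCount hm
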